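/- Let $\Sigma$ be a finite signed graph: it has finite vertex set $V$ and edge set $E$, loops and multiple edges are allowed, each edge has two ends, each attached to at most one vertex and at least one of them attached (an edge with exactly one attached end is an \emph{outer-edge}), and each edge carries a sign $\pm1$. A \emph{circle} is a connected subgraph with at least one edge and no outer-edges in which every vertex has degree $2$; it is \emph{negative} if the product of its edge signs is $-1$. A subgraph is \emph{balanced} if it has no outer-edges and no negative circles. Let $b(\Sigma)$ be the number of balanced connected components of $\Sigma$, and put $\mathrm{cr}(\Sigma)=|E|-|V|+b(\Sigma)$. For a nonempty $X\subseteq V$ let $\Sigma[X]$ be the subgraph on $X$ formed by the loops and links with all endpoints in $X$. For a switching $\nu:V\to\{\pm1\}$ with $\nu=1$ off $X$, let $\delta X^\nu$ consist of the links between $X$ and $V\setminus X$, the outer-edges at $X$, and the edges $e=uv$ of $\Sigma[X]$ with $\nu(u)\sigma(e)\nu(v)=-1$. A \emph{cut} is a nonempty edge set $U=\delta X^\nu$ such that $\Sigma[X]\setminus U$ is balanced and $(\Sigma[X]\setminus U)\cup e$ is unbalanced for each edge $e$ of $\Sigma[X]$ in $U$. A \emph{bond} is a minimal cut, and a \emph{co-loop}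 is an edge $e$ such that $\{e\}$ is a bond. An orientation of an edge puts an arrow at each of its two ends, the two arrows having the same direction along the edge if the edge is positive and opposite directions if it is negative; an edge with an orientation is an arc. For a vertex $v$ and an arc $\vec e$ let $[v,\vec e\,]$ be the sum over the ends of $e$ attached to $v$ of $+1$ if the arrow there points to $v$ and $-1$ otherwise. A \emph{nowhere-zero $\mathbb Z_n$-flow} is a function $f$ from arcs to $\mathbb Z/n\mathbb Z\setminus\{0\}$ with $f(\vec e^{\,-1})=-f(\vec e\,)$ for all arcs and $\sum_{e\in E}[v,\vec e\,]f(\vec e\,)=0$ for all $v\in V$. \textbf{Theorem.} Suppose that $\Sigma$ has no co-loops. Then there are periodic functions $a_k:\mathbb Z\to\mathbb Z$ $(0\le k\le \mathrm{cr}(\Sigma))$, with $a_{\mathrm{cr}(\Sigma)}$ not identically zero, such that for every integer $n\ge2$ the number of nowhere-zero $\mathbb Z_n$-flows of $\Sigma$ is $$\varphi(\Sigma,n)=\sum_{k=0}^{\mathrm{cr}(\Sigma)}a_k(n)\,n^k .$$ If $\Sigma$ contains a negative circle, then all $a_k$ have period $2$, and $2$ is the least common period of the $a_k$, that is, some $a_k$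 is not constant. If $\Sigma$ contains no negative circle, then all $a_k$ have period $1$, that is, they are constant. The quasi-polynomial is unique: if a quasi-polynomial with complex periodic coefficients, of any degree and any period, takes the value $\varphi(\Sigma,n)$ at every integer $n\ge2$, then its coefficient functions are the $a_k$ (with $a_k=0$ for $k>\mathrm{cr}(\Sigma)$). -/

import Mathlib

/-- A (finite, once `V` and `E` are finite) signed graph with possible outer-edges, on the vertex
set `V` and the edge set `E`.  Each edge has exactly two ends (labelled `false` and `true`; the
labels carry no meaning), each end is attached to one vertex (`some v`) or to none (`none`), and at
least one end is attached.  Loops, multiple edges and outer-edges are allowed. -/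
structure SignedGraph (V E : Type*) where
  ends : E → Bool → Option V
  attached : ∀ e, ∃ i, ends e i ≠ none
  sign : E → ℤˣ

namespace SignedGraph

variable {V E : Type*}

/-- An outer-edge: an edge having only one end attached to a vertex. -/
def IsOuter (G : SignedGraph V E) (e : E) : Prop := ∃ i, G.ends e i = none

/-- The vertex `v` is an endpoint of the edge `e`. -/
def Inc (G : SignedGraph V E) (v : V) (e : E) : Prop := ∃ i, G.ends e i = some v

/-- The simple graph on `V` in which two distinct vertices are adjacent when they are joined by a
link belonging to `S`; its connected components are those of the spanning subgraph `(V, S)`. -/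
def linkGraph (G : SignedGraph V E) (S : Set E) : SimpleGraph V :=
  SimpleGraph.fromRel fun u v => ∃ e ∈ S, ∃ i, G.ends e i = some u ∧ G.ends e (!i) = some v

open Classical in
/-- The degree of `v` in the edge set `C`; a loop at `v` counts twice. -/
noncomputable def degree (G : SignedGraph V E) (C : Finset E) (v : V) : ℕ :=
  ∑ e ∈ C, ∑ i : Bool, if G.ends e i = some v then 1 else 0

/-- `C` is the edge set of a circle: a connected subgraph with at least one edge, without
outer-edges, in which every vertex has degree two. -/
def IsCircle (G : SignedGraph V E) (C : Finset E) : Prop :=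
  C.Nonempty ∧ (∀ e ∈ C, ¬ G.IsOuter e) ∧
  (∀ v, (∃ e ∈ C, G.Inc v e) → G.degree C v = 2) ∧
  ∀ u v, (∃ e ∈ C, G.Inc u e) → (∃ e ∈ C, G.Inc v e) → (G.linkGraph (C : Set E)).Reachable u v

/-- A circle whose edge signs multiply to `-1`. -/
def IsNegativeCircle (G : SignedGraph V E) (C : Finset E) : Prop :=
  G.IsCircle C ∧ ∏ e ∈ C, G.sign e = -1

/-- A subgraph with edge set `S` is balanced: no outer-edges, and all circles are positive. -/
def Balanced (G : SignedGraph V E) (S : Set E) : Prop :=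
  (∀ e ∈ S, ¬ G.IsOuter e) ∧ ∀ C : Finset E, (C : Set E) ⊆ S → ¬ G.IsNegativeCircle C

/-- The edges of `S` lying in the component `K` of the spanning subgraph `(V, S)`. -/
def componentEdges (G : SignedGraph V E) (S : Set E) (K : (G.linkGraph S).ConnectedComponent) :
    Set E :=
  {e | e ∈ S ∧ ∃ v ∈ K.supp, G.Inc v e}

/-- `b(S)`: the number of balanced components of the spanning subgraph `(V, S)`. -/
noncomputable def numBalanced (G : SignedGraph V E) (S : Set E) : ℕ :=
  Nat.card {K : (G.linkGraph S).ConnectedComponent // G.Balanced (G.componentEdges S K)}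

/-- `r(S) = |V| - b(S)`. -/
noncomputable def rank (G : SignedGraph V E) (S : Set E) : ℕ := Nat.card V - G.numBalanced S

/-- `cr(S) = |S| - r(S)`; one always has `b(S) ≤ |V|` and `r(S) ≤ |S|`, so that the natural number
subtractions are exact. -/
noncomputable def cycleRank (G : SignedGraph V E) (S : Set E) : ℕ := S.ncard - G.rank S

/-! ### Cuts, bonds and co-loops -/

/-- The signed graph obtained by the switching `ν`. -/
def switch (G : SignedGraph V E) (ν : V → ℤˣ) : SignedGraph V E where
  ends := G.ends
  attached := G.attached
  sign e := G.sign e * ∏ i : Bool, (G.ends e i).elim 1 ν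

/-- The loops and links with all endpoints in `X`. -/
def inner (G : SignedGraph V E) (X : Set V) : Set E :=
  {e | ∀ i, ∃ v ∈ X, G.ends e i = some v}

/-- The links between `X` and its complement. -/
def between (G : SignedGraph V E) (X : Set V) : Set E :=
  {e | ∃ i, ∃ u ∈ X, ∃ w ∉ X, G.ends e i = some u ∧ G.ends e (!i) = some w}

/-- The outer-edges with endpoint in `X`. -/
def outer (G : SignedGraph V E) (X : Set V) : Set E :=
  {e | G.IsOuter e ∧ ∃ v ∈ X, G.Inc v e}

/-- The edge set consisting of the links between `X` and its complement, the outer-edges at `X`,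
and the edges inside `X` that are negative after the switching `ν`. -/
def switchedBoundary (G : SignedGraph V E) (X : Set V) (ν : V → ℤˣ) : Set E :=
  G.between X ∪ {e | e ∈ G.inner X ∧ (G.switch ν).sign e = -1} ∪ G.outer X

/-- A signed-graph cut. -/
def IsCut (G : SignedGraph V E) (U : Set E) : Prop :=
  U.Nonempty ∧ ∃ (X : Set V) (ν : V → ℤˣ), X.Nonempty ∧ (∀ v ∉ X, ν v = 1) ∧
    U = G.switchedBoundary X ν ∧ G.Balanced (G.inner X \ U) ∧
    ∀ e ∈ G.inner X ∩ U, ¬ G.Balanced (insert e (G.inner X \ U))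

/-- A bond: a cut that contains no other cut. -/
def IsBond (G : SignedGraph V E) (U : Set E) : Prop :=
  G.IsCut U ∧ ∀ U', G.IsCut U' → U' ⊆ U → U' = U

/-- A co-loop: an edge that is a bond. -/
def IsColoop (G : SignedGraph V E) (e : E) : Prop := G.IsBond {e}

/-! ### Arcs, chains and flows -/

/-- An arc: an edge with an arrow at each of its two ends.  The value `1` at an end means that the
arrow points towards that end, `-1` that it points away from it; so the two arrows have the same
direction along the edge exactly when the values are opposite, which is required for positive
edges, while negative edges carry equal values. -/
@[ext]
structure Arc (G : SignedGraph V E) where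
  edge : E
  arrow : Bool → ℤˣ
  arrow_mul : arrow false * arrow true = - G.sign edge

/-- The opposite arc. -/
def Arc.opp {G : SignedGraph V E} (a : G.Arc) : G.Arc where
  edge := a.edge
  arrow i := - a.arrow i
  arrow_mul := by rw [neg_mul_neg]; exact a.arrow_mul

/-- One of the two orientations of the edge `e`. -/
def refArc (G : SignedGraph V E) (e : E) : G.Arc where
  edge := e
  arrow i := if i then 1 else - G.sign e
  arrow_mul := by simp

/-- The incidence number `[v, a]`: the sum of the arrows of `a` at the ends attached to `v`.  It is
`±1` at the endpoints of a link or an outer-edge, `±2` for a negative loop at `v`, and `0` for a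
positive loop. -/
def incidence [DecidableEq V] (G : SignedGraph V E) (v : V) (a : G.Arc) : ℤ :=
  ∑ i : Bool, if G.ends a.edge i = some v then (a.arrow i : ℤ) else 0

/-- The group of `1`-chains over `A`: the odd functions on arcs. -/
def chains (G : SignedGraph V E) (A : Type*) [AddCommGroup A] : AddSubgroup (G.Arc → A) where
  carrier := {c | ∀ a, c a.opp = - c a}
  zero_mem' := by intro a; simp
  add_mem' := by
    intro c d hc hd a
    have h1 : c a.opp = - c a := hc a
    have h2 : d a.opp = - d a := hd a
    change c a.opp + d a.opp = - (c a + d a)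
    rw [h1, h2]
    abel
  neg_mem' := by
    intro c hc a
    have h1 : c a.opp = - c a := hc a
    change - c a.opp = - - c a
    rw [h1]

/-- The boundary `(∂c)(v) = ∑ e, [v, e] c(e)`, where each edge `e` is given one of its two
orientations; see `incidence_smul_opp` and `arc_eq_or` for the independence of that choice. -/
def boundary [DecidableEq V] [Fintype E] (G : SignedGraph V E) {A : Type*} [AddCommGroup A]
    (c : G.Arc → A) (v : V) : A :=
  ∑ e, G.incidence v (G.refArc e) • c (G.refArc e)

theorem arc_eq_or (G : SignedGraph V E) (a : G.Arc) :
    a = G.refArc a.edge ∨ a = (G.refArc a.edge).opp := by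
  obtain ⟨e, τ, h⟩ := a
  rcases Int.units_eq_one_or (τ true) with h1 | h1
  · left
    ext i
    · rfl
    · cases i
      · simpa [refArc, h1] using congrArg Units.val h
      · simp [refArc, h1]
  · right
    ext i
    · rfl
    · cases i
      · have : τ false = G.sign e := by simpa [h1] using h
        simp [refArc, Arc.opp, this]
      · simp [refArc, Arc.opp, h1]

theorem incidence_smul_opp [DecidableEq V] (G : SignedGraph V E) {A : Type*} [AddCommGroup A]
    {c : G.Arc → A} (hc : c ∈ G.chains A) (v : V) (a : G.Arc) :
    G.incidence v a.opp • c a.opp = G.incidence v a • c a := by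
  have h : G.incidence v a.opp = - G.incidence v a := by
    unfold incidence
    rw [← Finset.sum_neg_distrib]
    refine Finset.sum_congr rfl fun i _ => ?_
    by_cases hi : G.ends a.edge i = some v <;> simp [Arc.opp, hi]
  have hc' : c a.opp = - c a := hc a
  rw [h, hc', neg_smul_neg]

/-- The set of nowhere-zero flows over `A`: the `1`-chains with zero boundary that vanish on no
arc. -/
def nowhereZeroFlows [DecidableEq V] [Fintype E] (G : SignedGraph V E) (A : Type*)
    [AddCommGroup A] : Set (G.Arc → A) :=
  {c | c ∈ G.chains A ∧ (∀ v, G.boundary c v = 0) ∧ ∀ a, c a ≠ 0}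

end SignedGraph

/-! ### Quasi-polynomials -/

/-- The family `a k : ℤ → R` is the coefficient family of a quasi-polynomial
`n ↦ ∑ k, a k n * n ^ k`: the coefficients are periodic with a common period `N > 0`, and they
vanish for all `k > d`. -/
structure IsQuasiPolynomialCoeff {R : Type*} [Zero R] (a : ℕ → ℤ → R) (d : ℕ) : Prop where
  periodic : ∃ N : ℕ, 0 < N ∧ ∀ k, Function.Periodic (a k) (N : ℤ)
  vanish : ∀ k, d < k → a k = 0

/-- The value at `n` of the quasi-polynomial with coefficients `a 0, …, a d`. -/
def quasiEval {R : Type*} [Ring R] (a : ℕ → ℤ → R) (d : ℕ) (n : ℤ) : R :=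
  ∑ k ∈ Finset.range (d + 1), a k n * (n : R) ^ k

/-! Flows are counted by duality. The coboundary on potentials is adjoint to the boundary, so
summing an additive character of `ZMod n` over pairs (edge function on S, potential) in both orders
relates flows on S to potentials with zero coboundary on S (`card_flowsOn_mul`). Such a potential is
fixed by one value per component: arbitrary if the component is balanced, 2-torsion if it is
unbalanced without outer-edges, zero if it has an outer-edge; this rests on Harary's switching
criterion. Hence S carries n^cr(S) · gcd(n,2)^u(S) flows, where u(S) counts the unbalanced
components without outer-edges (`card_flowsOn`).

Inclusion–exclusion over the set T of edges where a flow is required to vanish gives the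
quasi-polynomial, with a_k collecting the T whose complement has cycle-rank k. If there are no
co-loops, removing any edge lowers the cycle-rank, so T = ∅ alone contributes to the top
coefficient.

For the exact period, suppose a negative circle exists. The differences of the even and odd values
of the a_k are alternating sums of t(T) - 1, with t(T) = 2^u(complement of T). If they all vanished,
so would the polynomial they form, evaluated at -1. Up to a global sign that value is
`signedExcess`, which is positive (`signedExcess_pos`): edges lowering the rank split it into a sum
of two such quantities, and once no edge lowers the rank it counts certain `ZMod 2`-flows up to a
power of 2.

Over `ZMod 3` the torsion factor is 1, so cycle-rank is the base-3 logarithm of a number of flows,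
and its properties are read off from counts. -/

namespace SignedGraph

/-! ### Duality between flows and potentials. -/

variable {V E : Type*}

/-- The coboundary of a potential `h` with respect to the reference orientation; unattached ends
contribute zero. -/
def coboundary {R : Type*} [CommRing R] (G : SignedGraph V E) (h : V → R) (e : E) : R :=
  (G.ends e true).elim 0 h - ((G.sign e : ℤ) : R) * (G.ends e false).elim 0 h

/-- The boundary of a function on edges with respect to the reference orientation. -/
def edgeBoundary {R : Type*} [CommRing R] [DecidableEq V] [Fintype E] (G : SignedGraph V E)
    (f : E → R) (v : V) : R :=
  ∑ e, (G.incidence v (G.refArc e) : R) * f e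

/-- Adjointness of boundary and coboundary: each edge contributes to the left side only at its
attached ends. -/
theorem sum_mul_edgeBoundary {R : Type*} [CommRing R] [Fintype V] [DecidableEq V] [Fintype E]
    (G : SignedGraph V E) (h : V → R) (f : E → R) :
    ∑ v, h v * G.edgeBoundary f v = ∑ e, f e * G.coboundary h e := by
  simp only [edgeBoundary, Finset.mul_sum]
  rw [Finset.sum_comm]
  refine Finset.sum_congr rfl fun e _ => ?_
  have key : ∀ (o : Option V) (x : ℤ),
      ∑ v, h v * (((if o = some v then x else 0 : ℤ) : R) * f e) = x * o.elim 0 h * f e := by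
    intro o x
    cases o with
    | none => simp
    | some u =>
      rw [Finset.sum_eq_single u]
      · simp; ring
      · intro v _ hv
        simp [Ne.symm hv]
      · simp
  have hsplit : ∀ v, h v * ((G.incidence v (G.refArc e) : R) * f e) =
      h v * (((if G.ends e true = some v then 1 else 0 : ℤ) : R) * f e) +
      h v * (((if G.ends e false = some v then - (G.sign e : ℤ) else 0 : ℤ) : R) * f e) := by
    intro v
    simp only [incidence, refArc, Fintype.sum_bool, if_true, Int.cast_add]
    simp [add_mul, mul_add]
  simp only [hsplit, Finset.sum_add_distrib, key]
  simp only [coboundary]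
  push_cast
  ring

open Classical in
/-- The flows with values in `R` that vanish outside `S`, as functions on edges. -/
noncomputable def flowsOn (R : Type*) [CommRing R] [Fintype R] [DecidableEq V] [Fintype V]
    [Fintype E] (G : SignedGraph V E) (S : Finset E) : Finset (E → R) :=
  {f | (∀ e ∉ S, f e = 0) ∧ ∀ v, G.edgeBoundary f v = 0}

open Classical in
/-- The potentials with values in `R` whose coboundary vanishes on `S`. -/
noncomputable def potentials (R : Type*) [CommRing R] [Fintype R] [Fintype V]
    (G : SignedGraph V E) (S : Finset E) : Finset (V → R) :=
  {h | ∀ e ∈ S, G.coboundary h e = 0}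

theorem mem_flowsOn {R : Type*} [CommRing R] [Fintype R] [DecidableEq V] [Fintype V]
    [Fintype E] {G : SignedGraph V E} {S : Finset E} {f : E → R} :
    f ∈ G.flowsOn R S ↔ (∀ e ∉ S, f e = 0) ∧ ∀ v, G.edgeBoundary f v = 0 := by
  simp [flowsOn]

theorem mem_potentials {R : Type*} [CommRing R] [Fintype R] [Fintype V]
    {G : SignedGraph V E} {S : Finset E} {h : V → R} :
    h ∈ G.potentials R S ↔ ∀ e ∈ S, G.coboundary h e = 0 := by
  simp [potentials]

/-- Orthogonality of characters, one coordinate at a time: the character sum factors over the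
coordinates, and primitivity kills every factor in S with nonzero `y i`. -/
theorem sum_addChar_pairing {R ι : Type*} [CommRing R] [Fintype R] [DecidableEq R] [Fintype ι]
    [DecidableEq ι]
    {ψ : AddChar R ℂ} (hψ : ψ.IsPrimitive) (S : Finset ι) (y : ι → R) :
    ∑ f ∈ Fintype.piFinset (fun i => if i ∈ S then (Finset.univ : Finset R) else {0}),
      ψ (∑ i, f i * y i) =
      if ∀ i ∈ S, y i = 0 then (Fintype.card R : ℂ) ^ S.card else 0 := by
  have h1 : ∀ f : ι → R, ψ (∑ i, f i * y i) = ∏ i, ψ (f i * y i) := fun f =>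
    map_prod ψ.toMonoidHom (fun i => Multiplicative.ofAdd (f i * y i)) Finset.univ
  simp only [h1]
  rw [← Finset.prod_univ_sum (fun i => if i ∈ S then (Finset.univ : Finset R) else {0})
    (fun i x => ψ (x * y i))]
  have h2 : ∀ i, ∑ x ∈ (if i ∈ S then (Finset.univ : Finset R) else {0}), ψ (x * y i) =
      if i ∈ S then (if y i = 0 then (Fintype.card R : ℂ) else 0) else 1 := by
    intro i
    by_cases hi : i ∈ S
    · simp only [hi, if_true]
      rw [AddChar.sum_mulShift (y i) hψ]
      split_ifs <;> simp
    · simp [hi]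
  simp only [h2]
  rw [Finset.prod_ite_mem, Finset.univ_inter]
  split_ifs with h
  · rw [Finset.prod_congr rfl fun i hi => if_pos (h i hi)]
    simp
  · push Not at h
    obtain ⟨i, hi, hy⟩ := h
    exact Finset.prod_eq_zero hi (if_neg hy)

theorem card_flowsOn_mul [Fintype V] [DecidableEq V] [Fintype E] (G : SignedGraph V E)
    (n : ℕ) [NeZero n] (S : Finset E) :
    (G.flowsOn (ZMod n) S).card * n ^ Fintype.card V =
      n ^ S.card * (G.potentials (ZMod n) S).card := by
  classical
  have hψ := ZMod.isPrimitive_stdAddChar n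
  set P := Fintype.piFinset (fun e => if e ∈ S then (Finset.univ : Finset (ZMod n)) else {0})
  have hP : ∀ f, f ∈ P ↔ ∀ e ∉ S, f e = 0 := by
    intro f
    simp only [P, Fintype.mem_piFinset]
    refine forall_congr' fun e => ?_
    by_cases he : e ∈ S <;> simp [he]
  -- Summing over the potentials first detects zero boundary; in `h2`, summing over the edge
  -- functions first detects zero coboundary on `S`.
  have h1 : ∑ f ∈ P, ∑ h : V → ZMod n, (ZMod.stdAddChar (∑ v, h v * G.edgeBoundary f v) : ℂ) =
      (G.flowsOn (ZMod n) S).card * (n : ℂ) ^ Fintype.card V := by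
    have : ∀ f ∈ P, ∑ h : V → ZMod n,
        (ZMod.stdAddChar (∑ v, h v * G.edgeBoundary f v) : ℂ) =
        if f ∈ G.flowsOn (ZMod n) S then (n : ℂ) ^ Fintype.card V else 0 := by
      intro f hf
      have := sum_addChar_pairing hψ (Finset.univ : Finset V) (G.edgeBoundary f)
      simp only [Finset.mem_univ, if_true, Fintype.piFinset_univ] at this
      rw [this]
      have hf' : f ∈ G.flowsOn (ZMod n) S ↔ ∀ v, G.edgeBoundary f v = 0 :=
        mem_flowsOn.trans ⟨And.right, And.intro ((hP f).1 hf)⟩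
      simp [hf']
    rw [Finset.sum_congr rfl this, ← Finset.sum_filter, Finset.sum_const, nsmul_eq_mul]
    congr 3
    ext f
    simp only [Finset.mem_filter, hP, mem_flowsOn]
    tauto
  have h2 : ∑ f ∈ P, ∑ h : V → ZMod n, (ZMod.stdAddChar (∑ v, h v * G.edgeBoundary f v) : ℂ) =
      (n : ℂ) ^ S.card * (G.potentials (ZMod n) S).card := by
    rw [Finset.sum_comm]
    have : ∀ h : V → ZMod n, ∑ f ∈ P,
        (ZMod.stdAddChar (∑ v, h v * G.edgeBoundary f v) : ℂ) =
        if h ∈ G.potentials (ZMod n) S then (n : ℂ) ^ S.card else 0 := by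
      intro h
      simp only [sum_mul_edgeBoundary]
      rw [sum_addChar_pairing hψ S (G.coboundary h)]
      simp [mem_potentials]
    simp only [this]
    rw [Finset.sum_ite_mem, Finset.univ_inter, Finset.sum_const, nsmul_eq_mul, mul_comm]
  exact_mod_cast h1.symm.trans h2

end SignedGraph

/-! ### Switching and Harary's theorem. -/

namespace SignedGraph

variable {V E : Type*}

/-- `ν` switches the edges of `S`, none of which is an outer-edge, to positive edges. -/
def SwitchesPositive (G : SignedGraph V E) (S : Set E) (ν : V → ℤˣ) : Prop :=
  ∀ e ∈ S, ¬ G.IsOuter e ∧ (G.switch ν).sign e = 1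

theorem exists_ends_of_not_isOuter {G : SignedGraph V E} {e : E} (he : ¬ G.IsOuter e) :
    ∃ u w, G.ends e true = some u ∧ G.ends e false = some w := by
  have h : ∀ i, ∃ u, G.ends e i = some u := fun i =>
    Option.ne_none_iff_exists'.1 fun hi => he ⟨i, hi⟩
  obtain ⟨u, hu⟩ := h true
  obtain ⟨w, hw⟩ := h false
  exact ⟨u, w, hu, hw⟩

theorem switch_sign_of_ends {G : SignedGraph V E} {e : E} {u w : V} (hu : G.ends e true = some u)
    (hw : G.ends e false = some w) (ν : V → ℤˣ) :
    (G.switch ν).sign e = G.sign e * (ν u * ν w) := by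
  simp [switch, hu, hw]

theorem coboundary_of_ends {R : Type*} [CommRing R] {G : SignedGraph V E} {e : E} {u w : V}
    (hu : G.ends e true = some u) (hw : G.ends e false = some w) (h : V → R) :
    G.coboundary h e = h u - ((G.sign e : ℤ) : R) * h w := by
  simp [coboundary, hu, hw]

/-- The coboundary of the potential that is `ν x` at both endpoints of a positively switched
edge. -/
theorem coboundary_eq_zero_of_switch {R : Type*} [CommRing R] {G : SignedGraph V E} {e : E}
    {u w : V} (hu : G.ends e true = some u) (hw : G.ends e false = some w) {ν : V → ℤˣ}
    (hν : (G.switch ν).sign e = 1) {h : V → R} {x : R} (h1 : h u = ((ν u : ℤ) : R) * x)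
    (h2 : h w = ((ν w : ℤ) : R) * x) : G.coboundary h e = 0 := by
  rw [switch_sign_of_ends hu hw] at hν
  rw [coboundary_of_ends hu hw, h1, h2]
  rcases Int.units_eq_one_or (G.sign e) with a | a <;>
  rcases Int.units_eq_one_or (ν u) with b | b <;>
  rcases Int.units_eq_one_or (ν w) with c | c <;>
  simp_all

/-- If the switched edge were negative, its coboundary would be ±2x. -/
theorem switch_eq_one_of_coboundary {R : Type*} [CommRing R] {G : SignedGraph V E} {e : E}
    {u w : V} (hu : G.ends e true = some u) (hw : G.ends e false = some w) {ν : V → ℤˣ}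
    {h : V → R} {x : R} (h1 : h u = ((ν u : ℤ) : R) * x)
    (h2 : h w = ((ν w : ℤ) : R) * x) (h0 : G.coboundary h e = 0) (hx : x + x ≠ 0) :
    (G.switch ν).sign e = 1 := by
  rw [switch_sign_of_ends hu hw]
  rw [coboundary_of_ends hu hw, h1, h2] at h0
  have hx' : ¬ (- x - x = 0) := fun h => hx (by linear_combination - h)
  rcases Int.units_eq_one_or (G.sign e) with a | a <;>
  rcases Int.units_eq_one_or (ν u) with b | b <;>
  rcases Int.units_eq_one_or (ν w) with c | c <;>
  simp_all

theorem sum_degree [Fintype V] (G : SignedGraph V E) (C : Finset E)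
    (hC : ∀ e ∈ C, ¬ G.IsOuter e) : ∑ v, G.degree C v = 2 * C.card := by
  classical
  unfold degree
  rw [Finset.sum_comm, Finset.sum_congr rfl (g := fun _ => 2)]
  · simp [mul_comm]
  · intro e he
    obtain ⟨u, w, hu, hw⟩ := exists_ends_of_not_isOuter (hC e he)
    simp only [Fintype.sum_bool, Finset.sum_add_distrib]
    rw [hu, hw]
    simp

theorem prod_switch_sign [Fintype V] (G : SignedGraph V E) (C : Finset E)
    (hC : ∀ e ∈ C, ¬ G.IsOuter e) (ν : V → ℤˣ) :
    ∏ e ∈ C, (G.switch ν).sign e = (∏ e ∈ C, G.sign e) * ∏ v, ν v ^ G.degree C v := by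
  classical
  have h : ∏ v, ν v ^ G.degree C v = ∏ e ∈ C, ∏ i : Bool, (G.ends e i).elim 1 ν := by
    unfold degree
    simp only [← Finset.prod_pow_eq_pow_sum]
    rw [Finset.prod_comm]
    refine Finset.prod_congr rfl fun e he => ?_
    obtain ⟨u, w, hu, hw⟩ := exists_ends_of_not_isOuter (hC e he)
    simp only [Fintype.prod_bool, Finset.prod_mul_distrib, pow_ite]
    rw [hu, hw]
    simp
  rw [h, ← Finset.prod_mul_distrib]
  rfl

theorem degree_eq_zero {G : SignedGraph V E} {C : Finset E} {v : V}
    (h : ¬ ∃ e ∈ C, G.Inc v e) : G.degree C v = 0 := by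
  unfold degree
  refine Finset.sum_eq_zero fun e he =>
    Finset.sum_eq_zero fun i _ => if_neg fun hi => h ⟨e, he, i, hi⟩

/-- Each vertex of the circle contributes `ν v` squared. -/
theorem IsCircle.prod_switch_sign [Fintype V] {G : SignedGraph V E} {C : Finset E}
    (hC : G.IsCircle C) (ν : V → ℤˣ) :
    ∏ e ∈ C, (G.switch ν).sign e = ∏ e ∈ C, G.sign e := by
  rw [SignedGraph.prod_switch_sign G C hC.2.1,
    Finset.prod_eq_one (f := fun v => ν v ^ G.degree C v), mul_one]
  intro v _
  by_cases h : ∃ e ∈ C, G.Inc v e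
  · rw [hC.2.2.1 v h]
    exact Int.units_sq _
  · rw [degree_eq_zero h, pow_zero]

theorem balanced_of_switchesPositive [Fintype V] {G : SignedGraph V E} {S : Set E} {ν : V → ℤˣ}
    (h : G.SwitchesPositive S ν) : G.Balanced S := by
  refine ⟨fun e he => (h e he).1, fun C hCS hC => ?_⟩
  have h1 := hC.1.prod_switch_sign ν
  rw [Finset.prod_eq_one fun e he => (h e (hCS he)).2, hC.2] at h1
  exact absurd h1 (by decide)

theorem linkGraph_reachable_of_ends {G : SignedGraph V E} {S : Set E} {e : E}
    (he : e ∈ S) {i j : Bool} {u w : V}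
    (hu : G.ends e i = some u) (hw : G.ends e j = some w) : (G.linkGraph S).Reachable u w := by
  by_cases h : u = w
  · exact h ▸ SimpleGraph.Reachable.refl _
  · have hj : j = !i := by
      rcases eq_or_ne j i with rfl | h'
      · exact absurd (Option.some.inj (hu.symm.trans hw)) h
      · cases i <;> cases j <;> simp_all
    subst hj
    refine SimpleGraph.Adj.reachable ?_
    rw [linkGraph, SimpleGraph.fromRel_adj]
    exact ⟨h, Or.inl ⟨e, he, i, hu, hw⟩⟩

/-- A minimal edge set, without outer-edges, that cannot be switched to be positive. -/
structure MinimalUnswitchable (G : SignedGraph V E) (C : Finset E) : Prop where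
  not_outer : ∀ e ∈ C, ¬ G.IsOuter e
  not_switches : ∀ ν, ¬ G.SwitchesPositive C ν
  minimal : ∀ C' ⊂ C, ∃ ν, G.SwitchesPositive (C' : Set E) ν

namespace MinimalUnswitchable

variable {G : SignedGraph V E} {C : Finset E}

open Classical in
theorem exists_erase (hC : G.MinimalUnswitchable C) {e : E} (he : e ∈ C) :
    ∃ ν, G.SwitchesPositive (C.erase e : Finset E) ν ∧ (G.switch ν).sign e = -1 := by
  obtain ⟨ν, hν⟩ := hC.minimal _ (Finset.erase_ssubset he)
  refine ⟨ν, hν, ?_⟩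
  rcases Int.units_eq_one_or ((G.switch ν).sign e) with h | h
  · refine absurd ?_ (hC.not_switches ν)
    intro e' he'
    by_cases hee : e' = e
    · exact hee ▸ ⟨hC.not_outer e he, h⟩
    · exact hν e' (by simpa [hee] using he')
  · exact h

theorem nonempty (hC : G.MinimalUnswitchable C) : C.Nonempty := by
  rw [Finset.nonempty_iff_ne_empty]
  rintro rfl
  exact hC.not_switches 1 fun e he => by simp at he

open Classical in
-- Otherwise C splits into two proper parts without common vertices, and their switchings glue to
-- one for C.
theorem reachable (hC : G.MinimalUnswitchable C) {u v : V} (hu : ∃ e ∈ C, G.Inc u e)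
    (hv : ∃ e ∈ C, G.Inc v e) : (G.linkGraph (C : Set E)).Reachable u v := by
  by_contra huv
  set K : V → Prop := fun w => (G.linkGraph (C : Set E)).Reachable u w with hK
  have hends : ∀ e ∈ C, ∃ a b, G.ends e true = some a ∧ G.ends e false = some b ∧ (K a ↔ K b) := by
    intro e he
    obtain ⟨a, b, ha, hb⟩ := exists_ends_of_not_isOuter (hC.not_outer e he)
    have := linkGraph_reachable_of_ends (Finset.mem_coe.2 he) ha hb
    exact ⟨a, b, ha, hb, fun h => h.trans this, fun h => h.trans this.symm⟩
  set C₁ := C.filter fun e => ∃ a, G.ends e true = some a ∧ K a with hC₁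
  set C₂ := C.filter fun e => ¬ ∃ a, G.ends e true = some a ∧ K a with hC₂
  have hsub₁ : C₁ ⊂ C := by
    obtain ⟨e, he, i, hi⟩ := hv
    refine Finset.filter_ssubset.2 ⟨e, he, ?_⟩
    rintro ⟨a, ha, ha'⟩
    exact huv (ha'.trans (linkGraph_reachable_of_ends (Finset.mem_coe.2 he) ha hi))
  have hsub₂ : C₂ ⊂ C := by
    obtain ⟨e, he, i, hi⟩ := hu
    refine Finset.filter_ssubset.2 ⟨e, he, ?_⟩
    obtain ⟨a, b, ha, hb, -⟩ := hends e he
    exact not_not.2 ⟨a, ha, linkGraph_reachable_of_ends (Finset.mem_coe.2 he) hi ha⟩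
  obtain ⟨ν₁, h₁⟩ := hC.minimal _ hsub₁
  obtain ⟨ν₂, h₂⟩ := hC.minimal _ hsub₂
  refine hC.not_switches (fun w => if K w then ν₁ w else ν₂ w) fun e he => ⟨hC.not_outer e he, ?_⟩
  obtain ⟨a, b, ha, hb, hab⟩ := hends e he
  rw [switch_sign_of_ends ha hb]
  by_cases hKa : K a
  · have := (h₁ e (by simpa [hC₁] using ⟨he, a, ha, hKa⟩)).2
    rw [switch_sign_of_ends ha hb] at this
    simpa only [hKa, hab.1 hKa, if_true] using this
  · have := (h₂ e (by simpa [hC₂, ha] using ⟨he, hKa⟩)).2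
    rw [switch_sign_of_ends ha hb] at this
    have hKb : ¬ K b := fun h => hKa (hab.2 h)
    simpa only [hKa, hKb, if_false] using this

open Classical in
-- If v met C in a single end, of the edge e, then flipping at v a switching that makes all of C but
-- e positive would repair e and affect nothing else in C.
theorem two_le_degree (hC : G.MinimalUnswitchable C) {v : V} (hv : ∃ e ∈ C, G.Inc v e) :
    2 ≤ G.degree C v := by
  obtain ⟨e, he, i, hi⟩ := hv
  by_contra hlt
  have hterm : ∀ e' ∈ C, (∑ j : Bool, if G.ends e' j = some v then 1 else 0) ≤ G.degree C v :=
    fun e' he' => Finset.single_le_sum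
      (f := fun e' => ∑ j : Bool, if G.ends e' j = some v then 1 else 0)
      (fun _ _ => Nat.zero_le _) he'
  have hother : ∀ e' ∈ C, e' ≠ e → ∀ j, G.ends e' j ≠ some v := by
    intro e' he' hne j hj
    apply hlt
    have h2 := Finset.add_le_sum
      (f := fun e' => ∑ j : Bool, if G.ends e' j = some v then 1 else 0)
      (fun _ _ => Nat.zero_le _) he he' (Ne.symm hne)
    have h3 : ∀ (e : E) (i : Bool), G.ends e i = some v →
        1 ≤ ∑ j : Bool, if G.ends e j = some v then 1 else 0 := by
      intro e i hi
      rw [Fintype.sum_bool]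
      cases i <;> simp [hi]
    exact le_trans (add_le_add (h3 e i hi) (h3 e' j hj)) h2
  have hself : G.ends e (!i) ≠ some v := by
    intro hj
    apply hlt
    refine le_trans ?_ (hterm e he)
    rw [Fintype.sum_bool]
    cases i
    · simp [show G.ends e true = some v from hj, hi]
    · simp [show G.ends e false = some v from hj, hi]
  obtain ⟨ν, hν, hs⟩ := hC.exists_erase he
  refine hC.not_switches (Function.update ν v (- ν v)) fun e' he' => ⟨hC.not_outer e' he', ?_⟩
  obtain ⟨a, b, ha, hb⟩ := exists_ends_of_not_isOuter (hC.not_outer e' he')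
  rw [switch_sign_of_ends ha hb]
  by_cases hee : e' = e
  · subst hee
    rw [switch_sign_of_ends ha hb] at hs
    cases i
    · have hbv : b = v := Option.some.inj (hb.symm.trans hi)
      have hav : a ≠ v := fun h => hself (by simpa [h] using ha)
      subst hbv
      rw [Function.update_self, Function.update_of_ne hav, mul_neg, mul_neg, hs, neg_neg]
    · have hav : a = v := Option.some.inj (ha.symm.trans hi)
      have hbv : b ≠ v := fun h => hself (by simpa [h] using hb)
      subst hav
      rw [Function.update_self, Function.update_of_ne hbv, neg_mul, mul_neg, hs, neg_neg]
  · have hav : a ≠ v := fun h => hother e' he' hee true (by rw [ha, h])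
    have hbv : b ≠ v := fun h => hother e' he' hee false (by rw [hb, h])
    rw [Function.update_of_ne hav, Function.update_of_ne hbv, ← switch_sign_of_ends ha hb]
    exact (hν e' (by simpa [hee] using he')).2

open Classical in
-- Duality over `ZMod 3`: C carries only the zero flow, while every potential vanishing on the
-- vertices of C has zero coboundary on C, which bounds 3^|C| by 3^|W|. The modulus is 3 because a
-- field with 2 ≠ 0 is needed.
theorem card_le (hC : G.MinimalUnswitchable C) [Fintype V] [Fintype E] :
    C.card ≤ (Finset.univ.filter fun v => ∃ e ∈ C, G.Inc v e).card := by
  have h11 : (1 : ZMod 3) + 1 ≠ 0 := by decide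
  set W := Finset.univ.filter fun v => ∃ e ∈ C, G.Inc v e with hW
  have : Fact (Nat.Prime 3) := ⟨Nat.prime_three⟩
  have hflow : ∀ f ∈ G.flowsOn (ZMod 3) C, f = 0 := by
    intro f hf
    rw [mem_flowsOn] at hf
    funext e
    by_cases he : e ∈ C
    -- Read as a potential, `ν` has nonzero coboundary within `C` only at `e`; pairing it with the
    -- flow isolates `f e`.
    · obtain ⟨ν, hν, hs⟩ := hC.exists_erase he
      have hsum := G.sum_mul_edgeBoundary (fun v => ((ν v : ℤ) : ZMod 3)) f
      rw [Finset.sum_eq_zero fun v _ => by rw [hf.2 v, mul_zero], Finset.sum_eq_single e] at hsum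
      · rcases mul_eq_zero.1 hsum.symm with h | h
        · exact h
        · obtain ⟨a, b, ha, hb⟩ := exists_ends_of_not_isOuter (hC.not_outer e he)
          have := switch_eq_one_of_coboundary ha hb (ν := ν) (x := (1 : ZMod 3)) (by simp)
            (by simp) h h11
          rw [this] at hs
          exact absurd hs (by decide)
      · intro e' _ hne
        by_cases he' : e' ∈ C
        · obtain ⟨a, b, ha, hb⟩ := exists_ends_of_not_isOuter (hC.not_outer e' he')
          rw [coboundary_eq_zero_of_switch ha hb (hν e' (by simpa [hne] using he')).2
            (x := (1 : ZMod 3)) (by simp) (by simp), mul_zero]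
        · rw [hf.1 e' he', zero_mul]
      · simp
    · exact hf.1 e he
  have hN : (G.flowsOn (ZMod 3) C).card ≤ 1 :=
    Finset.card_le_one.2 fun f hf g hg => (hflow f hf).trans (hflow g hg).symm
  have hM : 3 ^ (Fintype.card V - W.card) ≤ (G.potentials (ZMod 3) C).card := by
    have h1 : (Fintype.piFinset fun v => if v ∈ W then ({0} : Finset (ZMod 3)) else Finset.univ)
        ⊆ G.potentials (ZMod 3) C := by
      intro h hh
      rw [Fintype.mem_piFinset] at hh
      rw [mem_potentials]
      intro e he
      obtain ⟨a, b, ha, hb⟩ := exists_ends_of_not_isOuter (hC.not_outer e he)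
      have h0 : ∀ i v, G.ends e i = some v → h v = 0 := by
        intro i v hi
        have hv : v ∈ W := by simpa [hW] using ⟨e, he, i, hi⟩
        simpa [hv] using hh v
      rw [coboundary_of_ends ha hb, h0 _ _ ha, h0 _ _ hb]
      simp
    refine le_trans (le_of_eq ?_) (Finset.card_le_card h1)
    rw [Fintype.card_piFinset]
    have : ∀ v, (if v ∈ W then ({0} : Finset (ZMod 3)) else Finset.univ).card =
        if v ∈ Wᶜ then 3 else 1 := by
      intro v
      by_cases hv : v ∈ W <;> simp [hv, ZMod.card]
    simp only [this]
    rw [Finset.prod_ite_mem, Finset.univ_inter, Finset.prod_const, Finset.card_compl]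
  have hdual := G.card_flowsOn_mul 3 C
  have h2 : 3 ^ (C.card + (Fintype.card V - W.card)) ≤ 3 ^ Fintype.card V := by
    calc 3 ^ (C.card + (Fintype.card V - W.card))
        = 3 ^ C.card * 3 ^ (Fintype.card V - W.card) := pow_add _ _ _
      _ ≤ 3 ^ C.card * (G.potentials (ZMod 3) C).card := Nat.mul_le_mul_left _ hM
      _ = (G.flowsOn (ZMod 3) C).card * 3 ^ Fintype.card V := hdual.symm
      _ ≤ 1 * 3 ^ Fintype.card V := Nat.mul_le_mul_right _ hN
      _ = _ := one_mul _
  have h3 := (Nat.pow_le_pow_iff_right (by norm_num : 1 < 3)).1 h2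
  have h4 : W.card ≤ Fintype.card V := Finset.card_le_univ W
  omega

/-- The handshake identity and `card_le` leave no room: the degrees sum to 2|C| ≤ 2|W|, and each is
at least 2. -/
theorem degree_eq_two (hC : G.MinimalUnswitchable C) [Fintype V] [Fintype E] {v : V}
    (hv : ∃ e ∈ C, G.Inc v e) : G.degree C v = 2 := by
  classical
  set W := Finset.univ.filter fun v => ∃ e ∈ C, G.Inc v e with hW
  have h1 : ∑ v ∈ W, G.degree C v = 2 * C.card := by
    rw [← sum_degree G C hC.not_outer]
    refine Finset.sum_subset (Finset.subset_univ _) fun v _ hv => degree_eq_zero ?_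
    simpa [hW] using hv
  have hle : ∀ v ∈ W, 2 ≤ G.degree C v := fun v hv => hC.two_le_degree (by simpa [hW] using hv)
  have h2 : ∑ v ∈ W, 2 = ∑ v ∈ W, G.degree C v := by
    refine le_antisymm (Finset.sum_le_sum hle) ?_
    rw [h1, Finset.sum_const, smul_eq_mul, mul_comm]
    exact Nat.mul_le_mul_right _ hC.card_le
  exact ((Finset.sum_eq_sum_iff_of_le hle).1 h2 v (by simpa [hW] using hv)).symm

theorem isCircle (hC : G.MinimalUnswitchable C) [Fintype V] [Fintype E] : G.IsCircle C :=
  ⟨hC.nonempty, hC.not_outer, fun _ hv => hC.degree_eq_two hv, fun _ _ hu hv => hC.reachable hu hv⟩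

theorem isNegativeCircle (hC : G.MinimalUnswitchable C) [Fintype V] [Fintype E] :
    G.IsNegativeCircle C := by
  classical
  refine ⟨hC.isCircle, ?_⟩
  obtain ⟨e, he⟩ := hC.nonempty
  obtain ⟨ν, hν, hs⟩ := hC.exists_erase he
  rw [← hC.isCircle.prod_switch_sign ν, ← Finset.mul_prod_erase _ _ he, hs,
    Finset.prod_eq_one fun e' he' => (hν e' he').2, mul_one]

end MinimalUnswitchable

/-- Harary's theorem: an edge set is balanced if and only if it can be switched to be positive. -/
theorem balanced_iff_exists_switchesPositive [Fintype V] [Fintype E] {G : SignedGraph V E}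
    {S : Set E} : G.Balanced S ↔ ∃ ν, G.SwitchesPositive S ν := by
  classical
  refine ⟨fun hS => ?_, fun ⟨ν, hν⟩ => balanced_of_switchesPositive hν⟩
  by_contra hν
  push Not at hν
  have hne : (Finset.univ.filter fun C : Finset E =>
      (C : Set E) ⊆ S ∧ ∀ ν, ¬ G.SwitchesPositive C ν).Nonempty :=
    ⟨S.toFinset, by simpa using hν⟩
  -- A minimal subset of `S` that cannot be switched to be positive is a negative circle.
  obtain ⟨C, hC⟩ := Finset.exists_minimal hne
  have hC1 := hC.prop
  simp only [Finset.mem_filter, Finset.mem_univ, true_and] at hC1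
  refine hS.2 C hC1.1 (MinimalUnswitchable.isNegativeCircle
    ⟨fun e he => hS.1 e (hC1.1 he), hC1.2, ?_⟩)
  intro C' hC'
  by_contra hcon
  push Not at hcon
  refine hC.not_lt (y := C') ?_ hC'
  simp only [Finset.mem_filter, Finset.mem_univ, true_and]
  exact ⟨fun e he => hC1.1 (hC'.1 he), hcon⟩

end SignedGraph

/-! ### Counting potentials component by component. -/

namespace SignedGraph

variable {V E : Type*}

/-- The number of components of `(V, S)` that have no outer-edges and are not balanced. -/
noncomputable def numUnbalancedClosed (G : SignedGraph V E) (S : Set E) : ℕ :=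
  Nat.card {K : (G.linkGraph S).ConnectedComponent //
    (∀ e ∈ G.componentEdges S K, ¬ G.IsOuter e) ∧ ¬ G.Balanced (G.componentEdges S K)}

/-- The values that potentials vanishing on `S` can take at a vertex of the component `K`. -/
def allowedValues (R : Type*) [CommRing R] (G : SignedGraph V E) (S : Set E)
    (K : (G.linkGraph S).ConnectedComponent) : Set R :=
  {x | (¬ G.Balanced (G.componentEdges S K) → x + x = 0) ∧
    ((∃ e ∈ G.componentEdges S K, G.IsOuter e) → x = 0)}

theorem Inc.mem_componentEdges {G : SignedGraph V E} {S : Set E} {e : E} {v : V} (h : G.Inc v e)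
    (he : e ∈ S) : e ∈ G.componentEdges S ((G.linkGraph S).connectedComponentMk v) :=
  ⟨he, v, rfl, h⟩

theorem Inc.connectedComponentMk_eq {G : SignedGraph V E} {S : Set E} {e : E} {v w : V}
    (hv : G.Inc v e) (hw : G.Inc w e) (he : e ∈ S) :
    (G.linkGraph S).connectedComponentMk v = (G.linkGraph S).connectedComponentMk w := by
  obtain ⟨i, hi⟩ := hv
  obtain ⟨j, hj⟩ := hw
  exact SimpleGraph.ConnectedComponent.sound
    (linkGraph_reachable_of_ends he hi hj)

theorem Inc.connectedComponentMk_of_mem {G : SignedGraph V E} {S : Set E} {e : E} {v : V}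
    {K : (G.linkGraph S).ConnectedComponent} (hv : G.Inc v e) (he : e ∈ G.componentEdges S K) :
    (G.linkGraph S).connectedComponentMk v = K := by
  obtain ⟨heS, w, hw, hwe⟩ := he
  exact (hv.connectedComponentMk_eq hwe heS).trans hw

/-- τ is the product of the edge signs along a walk, so it is the same for all potentials. -/
theorem exists_mul_of_reachable {R : Type*} [CommRing R] {G : SignedGraph V E} {S : Set E}
    {u v : V} (huv : (G.linkGraph S).Reachable u v) :
    ∃ τ : ℤˣ, ∀ h : V → R, (∀ e ∈ S, G.coboundary h e = 0) → h v = ((τ : ℤ) : R) * h u := by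
  obtain ⟨p⟩ := huv
  induction p with
  | nil => exact ⟨1, fun h _ => by simp⟩
  | @cons a b c hab _ ih =>
    obtain ⟨τ, hτ⟩ := ih
    rw [linkGraph, SimpleGraph.fromRel_adj] at hab
    have key : ∃ e ∈ S, ∃ i, G.ends e i = some a ∧ G.ends e (!i) = some b := by
      rcases hab.2 with h | ⟨e, he, i, hi⟩
      · exact h
      · exact ⟨e, he, !i, hi.2, by simpa using hi.1⟩
    obtain ⟨e, he, i, ha, hb⟩ := key
    refine ⟨τ * G.sign e, fun h hh => ?_⟩
    have h1 : h b = ((G.sign e : ℤ) : R) * h a := by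
      have h0 := hh e he
      cases i
      · rw [coboundary_of_ends hb ha] at h0
        exact sub_eq_zero.1 h0
      · rw [coboundary_of_ends ha hb, sub_eq_zero] at h0
        rw [h0, ← mul_assoc, ← Int.cast_mul, Int.units_coe_mul_self, Int.cast_one, one_mul]
    rw [hτ h hh, h1, Units.val_mul, Int.cast_mul, mul_assoc]

theorem eq_zero_of_isOuter {R : Type*} [CommRing R] {G : SignedGraph V E} {h : V → R} {e : E}
    {v : V} (he : G.IsOuter e) (hv : G.Inc v e) (h0 : G.coboundary h e = 0) : h v = 0 := by
  obtain ⟨i, hi⟩ := he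
  obtain ⟨j, hj⟩ := hv
  rcases Int.units_eq_one_or (G.sign e) with a | a <;>
  cases i <;> cases j <;> simp_all [coboundary]

theorem coboundary_eq_zero_of_inc {R : Type*} [CommRing R] {G : SignedGraph V E} {h : V → R}
    {e : E} (h0 : ∀ v, G.Inc v e → h v = 0) : G.coboundary h e = 0 := by
  have key : ∀ i, (G.ends e i).elim 0 h = 0 := by
    intro i
    cases hi : G.ends e i with
    | none => rfl
    | some v => exact h0 v ⟨i, hi⟩
  rw [coboundary, key, key]
  simp

/-- All values on the component are ±h(r). If 2h(r) ≠ 0 and there is no outer-edge, these signs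
switch the component to be positive, so it is balanced. -/
theorem mem_allowedValues [Fintype V] {R : Type*} [CommRing R] {G : SignedGraph V E} {S : Set E}
    {h : V → R} (hh : ∀ e ∈ S, G.coboundary h e = 0) (r : V) :
    h r ∈ G.allowedValues R S ((G.linkGraph S).connectedComponentMk r) := by
  classical
  set K := (G.linkGraph S).connectedComponentMk r with hK
  have hreach : ∀ v, (G.linkGraph S).connectedComponentMk v = K → ∃ τ : ℤˣ,
      h v = ((τ : ℤ) : R) * h r := by
    intro v hv
    obtain ⟨τ, hτ⟩ := exists_mul_of_reachable (R := R)
      (SimpleGraph.ConnectedComponent.exact hv).symm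
    exact ⟨τ, hτ h hh⟩
  have houter : (∃ e ∈ G.componentEdges S K, G.IsOuter e) → h r = 0 := by
    rintro ⟨e, he, ho⟩
    obtain ⟨heS, v, hv, hve⟩ := he
    obtain ⟨τ, hτ⟩ := hreach v hv
    rw [eq_zero_of_isOuter ho hve (hh e heS)] at hτ
    rcases Int.units_eq_one_or τ with a | a
    · simpa [a] using hτ.symm
    · simpa [a] using hτ.symm
  refine ⟨fun hb => ?_, houter⟩
  by_cases ho : ∃ e ∈ G.componentEdges S K, G.IsOuter e
  · rw [houter ho, add_zero]
  by_contra hx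
  push Not at ho
  have hchoice : ∀ v, ∃ τ : ℤˣ, (G.linkGraph S).connectedComponentMk v = K →
      h v = ((τ : ℤ) : R) * h r := by
    intro v
    by_cases hv : (G.linkGraph S).connectedComponentMk v = K
    · obtain ⟨τ, hτ⟩ := hreach v hv
      exact ⟨τ, fun _ => hτ⟩
    · exact ⟨1, fun h => absurd h hv⟩
  choose ν hν using hchoice
  refine hb (balanced_of_switchesPositive (ν := ν) fun e he => ⟨ho e he, ?_⟩)
  obtain ⟨a, b, ha, hb⟩ := exists_ends_of_not_isOuter (ho e he)
  exact switch_eq_one_of_coboundary ha hb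
    (hν a (Inc.connectedComponentMk_of_mem ⟨_, ha⟩ he))
    (hν b (Inc.connectedComponentMk_of_mem ⟨_, hb⟩ he)) (hh e he.1) hx

theorem exists_potential [Fintype V] [Fintype E] {R : Type*} [CommRing R] {G : SignedGraph V E}
    {S : Set E} (x : (G.linkGraph S).ConnectedComponent → R)
    (hx : ∀ K, x K ∈ G.allowedValues R S K) :
    ∃ h : V → R, (∀ e ∈ S, G.coboundary h e = 0) ∧ ∀ K, h (Quot.out K) = x K := by
  classical
  have hchoice : ∀ K : (G.linkGraph S).ConnectedComponent, ∃ ν : V → ℤˣ,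
      G.Balanced (G.componentEdges S K) → G.SwitchesPositive (G.componentEdges S K) ν := by
    intro K
    by_cases hK : G.Balanced (G.componentEdges S K)
    · obtain ⟨ν, hν⟩ := balanced_iff_exists_switchesPositive.1 hK
      exact ⟨ν, fun _ => hν⟩
    · exact ⟨1, fun h => absurd h hK⟩
  choose ν hν using hchoice
  -- On a balanced component the potential follows the switching, normalized by its sign at the
  -- root. Elsewhere it is constant, which works because 2x = 0 makes signs irrelevant.
  refine ⟨fun v => if G.Balanced (G.componentEdges S ((G.linkGraph S).connectedComponentMk v)) then
    ((ν ((G.linkGraph S).connectedComponentMk v) v : ℤ) : R) *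
      (((ν ((G.linkGraph S).connectedComponentMk v)
        (Quot.out ((G.linkGraph S).connectedComponentMk v)) : ℤ) : R) *
        x ((G.linkGraph S).connectedComponentMk v))
    else x ((G.linkGraph S).connectedComponentMk v), fun e he => ?_, fun K => ?_⟩
  · by_cases ho : G.IsOuter e
    · refine coboundary_eq_zero_of_inc fun v hv => ?_
      have h0 := (hx ((G.linkGraph S).connectedComponentMk v)).2
        ⟨e, hv.mem_componentEdges he, ho⟩
      simp [h0]
    · obtain ⟨a, b, ha, hb⟩ := exists_ends_of_not_isOuter ho
      have hab : (G.linkGraph S).connectedComponentMk a =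
          (G.linkGraph S).connectedComponentMk b :=
        Inc.connectedComponentMk_eq ⟨_, ha⟩ ⟨_, hb⟩ he
      have heK : e ∈ G.componentEdges S ((G.linkGraph S).connectedComponentMk b) :=
        Inc.mem_componentEdges ⟨_, hb⟩ he
      by_cases hbal : G.Balanced (G.componentEdges S ((G.linkGraph S).connectedComponentMk b))
      · refine coboundary_eq_zero_of_switch ha hb (hν _ hbal e heK).2
          (x := ((ν ((G.linkGraph S).connectedComponentMk b)
            (Quot.out ((G.linkGraph S).connectedComponentMk b)) : ℤ) : R) *
            x ((G.linkGraph S).connectedComponentMk b)) ?_ ?_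
        · simp only [hab, hbal, if_true]
        · simp only [hbal, if_true]
      · rw [coboundary_of_ends ha hb]
        simp only [hab, hbal, if_false]
        have h0 := (hx ((G.linkGraph S).connectedComponentMk b)).1 hbal
        rcases Int.units_eq_one_or (G.sign e) with a | a <;> simp [a, h0]
  · have hK : (G.linkGraph S).connectedComponentMk (Quot.out K) = K := Quot.out_eq K
    simp only [hK]
    split_ifs
    · rw [← mul_assoc, ← Int.cast_mul, Int.units_coe_mul_self, Int.cast_one, one_mul]
    · rfl

theorem card_potentials_eq_prod [Fintype V] [Fintype E] (R : Type*) [CommRing R] [Fintype R]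
    (G : SignedGraph V E) (S : Finset E) [Fintype (G.linkGraph (S : Set E)).ConnectedComponent] :
    (G.potentials R S).card =
      ∏ K : (G.linkGraph (S : Set E)).ConnectedComponent, Nat.card (G.allowedValues R S K) := by
  rw [← Nat.card_pi, ← Fintype.card_coe, ← Nat.card_eq_fintype_card]
  refine Nat.card_eq_of_bijective (fun h K => ⟨h.1 (Quot.out K), ?_⟩) ⟨?_, ?_⟩
  · have hK : (G.linkGraph (S : Set E)).connectedComponentMk (Quot.out K) = K := Quot.out_eq K
    have := mem_allowedValues (mem_potentials.1 h.2) (Quot.out K)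
    rwa [hK] at this
  · rintro ⟨h₁, hh₁⟩ ⟨h₂, hh₂⟩ heq
    refine Subtype.ext (funext fun v => ?_)
    obtain ⟨τ, hτ⟩ := exists_mul_of_reachable (R := R) (SimpleGraph.ConnectedComponent.exact
      (Quot.out_eq ((G.linkGraph (S : Set E)).connectedComponentMk v)))
    have hroot := congrArg Subtype.val
      (congrFun heq ((G.linkGraph (S : Set E)).connectedComponentMk v))
    change h₁ v = h₂ v
    rw [hτ h₁ (mem_potentials.1 hh₁), hτ h₂ (mem_potentials.1 hh₂)]
    exact congrArg _ hroot
  · intro x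
    obtain ⟨h, hh, hx⟩ := exists_potential (G := G) (S := (S : Set E)) (R := R)
      (fun K => (x K : R)) fun K => (x K).2
    exact ⟨⟨h, mem_potentials.2 hh⟩, funext fun K => Subtype.ext (hx K)⟩

theorem card_two_torsion (n : ℕ) [NeZero n] :
    Nat.card {x : ZMod n | x + x = 0} = n.gcd 2 := by
  have h := IsAddCyclic.card_nsmulAddMonoidHom_ker (G := ZMod n) 2
  rw [Nat.card_zmod] at h
  rw [← h]
  refine Nat.card_congr (Equiv.setCongr ?_)
  ext x
  simp [two_mul]

theorem card_allowedValues (G : SignedGraph V E) (S : Set E) (n : ℕ) [NeZero n]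
    (K : (G.linkGraph S).ConnectedComponent) [Decidable (G.Balanced (G.componentEdges S K))]
    [Decidable ((∀ e ∈ G.componentEdges S K, ¬ G.IsOuter e) ∧
      ¬ G.Balanced (G.componentEdges S K))] :
    Nat.card (G.allowedValues (ZMod n) S K) =
      (if G.Balanced (G.componentEdges S K) then n else 1) *
      (if (∀ e ∈ G.componentEdges S K, ¬ G.IsOuter e) ∧
        ¬ G.Balanced (G.componentEdges S K) then n.gcd 2 else 1) := by
  by_cases hb : G.Balanced (G.componentEdges S K)
  · have : G.allowedValues (ZMod n) S K = Set.univ := by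
      ext x
      simp only [allowedValues, Set.mem_ofPred_eq, Set.mem_univ, iff_true]
      exact ⟨fun h => absurd hb h, fun ⟨e, he, ho⟩ => absurd ho (hb.1 e he)⟩
    rw [this, Nat.card_congr (Equiv.Set.univ _)]
    simp [hb]
  · by_cases ho : ∀ e ∈ G.componentEdges S K, ¬ G.IsOuter e
    · have : G.allowedValues (ZMod n) S K = {x | x + x = 0} := by
        ext x
        simp only [allowedValues, Set.mem_ofPred_eq]
        exact ⟨fun h => h.1 hb, fun h => ⟨fun _ => h, fun ⟨e, he, hoe⟩ => absurd hoe (ho e he)⟩⟩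
      rw [this, card_two_torsion, if_neg hb, if_pos ⟨ho, hb⟩, one_mul]
    · have : G.allowedValues (ZMod n) S K = {0} := by
        push Not at ho
        ext x
        simp only [allowedValues, Set.mem_ofPred_eq, Set.mem_singleton_iff]
        exact ⟨fun h => h.2 ho, fun h => ⟨fun _ => by rw [h, add_zero], fun _ => h⟩⟩
      rw [this, if_neg hb, if_neg fun h => ho h.1]
      simp

theorem card_potentials [Fintype V] [Fintype E] (G : SignedGraph V E) (n : ℕ) [NeZero n]
    (S : Finset E) : (G.potentials (ZMod n) S).card =
      n ^ G.numBalanced (S : Set E) * n.gcd 2 ^ G.numUnbalancedClosed (S : Set E) := by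
  classical
  have : Fintype (G.linkGraph (S : Set E)).ConnectedComponent := Fintype.ofFinite _
  rw [card_potentials_eq_prod]
  simp only [card_allowedValues, Finset.prod_mul_distrib]
  simp only [Finset.prod_ite, Finset.prod_const_one, mul_one, Finset.prod_const,
    numBalanced, numUnbalancedClosed, Nat.card_eq_fintype_card, Fintype.card_subtype]

end SignedGraph

/-! ### Co-loops from potentials over `ZMod 3`. -/

namespace SignedGraph

variable {V E : Type*}

theorem isColoop_of_isCut_singleton {G : SignedGraph V E} {e : E} (h : G.IsCut {e}) :
    G.IsColoop e :=
  ⟨h, fun _ hU' hsub => (hU'.1.subset_singleton_iff).1 hsub⟩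

theorem isOuter_or_exists_ends (G : SignedGraph V E) (e : E) :
    G.IsOuter e ∨ ∃ u w, G.ends e true = some u ∧ G.ends e false = some w := by
  by_cases h : G.IsOuter e
  · exact Or.inl h
  · exact Or.inr (exists_ends_of_not_isOuter h)

theorem coboundary_sub {R : Type*} [CommRing R] (G : SignedGraph V E) (h h' : V → R) (e : E) :
    G.coboundary (h - h') e = G.coboundary h e - G.coboundary h' e := by
  have key : ∀ o : Option V, o.elim 0 (h - h') = o.elim 0 h - o.elim 0 h' := by
    intro o; cases o <;> simp
  simp only [coboundary, key]
  ring

/-- If the only edge with nonzero coboundary of `h` is `e`, the support of `h` defines a vertex set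
whose switched boundary is `{e}`. -/
theorem switchedBoundary_support {G : SignedGraph V E} {e : E} {h : V → ZMod 3} {ν : V → ℤˣ}
    (hν : ∀ v, h v ≠ 0 → h v = ((ν v : ℤ) : ZMod 3) * 1) (hh : ∀ e' ≠ e, G.coboundary h e' = 0)
    (hne : G.coboundary h e ≠ 0) : G.switchedBoundary {v | h v ≠ 0} ν = {e} := by
  have h11 : (1 : ZMod 3) + 1 ≠ 0 := by decide
  have hunit : ∀ s : ℤˣ, ((s : ℤ) : ZMod 3) ≠ 0 := by decide
  refine Set.Subset.antisymm (fun e' he' => ?_) ?_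
  · by_contra hee
    have h0 := hh e' hee
    rcases he' with (⟨i, u, hu, w, hw, hi, hj⟩ | ⟨hin, hs⟩) | ⟨ho, v, hv, hve⟩
    · have hw0 : h w = 0 := not_not.1 hw
      refine hu ?_
      cases i
      · rw [coboundary_of_ends hj hi, hw0, zero_sub, neg_eq_zero] at h0
        have : Fact (Nat.Prime 3) := ⟨Nat.prime_three⟩
        exact (mul_eq_zero.1 h0).resolve_left (hunit _)
      · rw [coboundary_of_ends hi hj, hw0, mul_zero, sub_zero] at h0
        exact h0
    · obtain ⟨u, hu, hu'⟩ := hin true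
      obtain ⟨w, hw, hw'⟩ := hin false
      rw [switch_eq_one_of_coboundary hu' hw' (hν u hu) (hν w hw) h0 h11] at hs
      exact absurd hs (by decide)
    · exact hv (eq_zero_of_isOuter ho hve h0)
  · rw [Set.singleton_subset_iff]
    rcases G.isOuter_or_exists_ends e with ho | ⟨a, b, ha, hb⟩
    · refine Or.inr ⟨ho, ?_⟩
      by_contra hcon
      push Not at hcon
      exact hne (coboundary_eq_zero_of_inc fun v hv => by
        by_contra h0
        exact hcon v h0 hv)
    · left
      by_cases hA : h a = 0 <;> by_cases hB : h b = 0
      · exact absurd (by rw [coboundary_of_ends ha hb, hA, hB]; simp) hne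
      · exact Or.inl ⟨false, b, hB, a, not_not.2 hA, hb, ha⟩
      · exact Or.inl ⟨true, a, hA, b, not_not.2 hB, ha, hb⟩
      · refine Or.inr ⟨fun i => ?_, ?_⟩
        · cases i
          · exact ⟨b, hB, hb⟩
          · exact ⟨a, hA, ha⟩
        · rcases Int.units_eq_one_or ((G.switch ν).sign e) with hs | hs
          · exact absurd (coboundary_eq_zero_of_switch ha hb hs (hν a hA) (hν b hB)) hne
          · exact hs

/-- An edge is a co-loop if some potential over the integers modulo three has nonzero coboundary
at that edge only. -/
theorem isColoop_of_coboundary [Fintype V] [Fintype E] {G : SignedGraph V E} {e : E}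
    (hex : ∃ h : V → ZMod 3, (∀ e' ≠ e, G.coboundary h e' = 0) ∧ G.coboundary h e ≠ 0) :
    G.IsColoop e := by
  classical
  obtain ⟨h₀, hh₀⟩ := hex
  -- Minimal support is what yields the last condition in the definition of a cut.
  obtain ⟨h, hmem, hmin⟩ := Finset.exists_min_image
    (Finset.univ.filter fun h : V → ZMod 3 =>
      (∀ e' ≠ e, G.coboundary h e' = 0) ∧ G.coboundary h e ≠ 0)
    (fun h => (Finset.univ.filter fun v => h v ≠ 0).card) ⟨h₀, by simpa using hh₀⟩
  simp only [Finset.mem_filter, Finset.mem_univ, true_and] at hmem hmin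
  obtain ⟨hh, hne⟩ := hmem
  have h3 : ∀ x : ZMod 3, x ≠ 0 → x = (((if x = -1 then -1 else 1 : ℤˣ) : ℤ) : ZMod 3) * 1 := by
    decide
  have h3' : ∀ x : ZMod 3, ∀ s : ℤˣ, x ≠ 0 → x ≠ ((s : ℤ) : ZMod 3) →
      x = - ((s : ℤ) : ZMod 3) := by
    decide
  set ν : V → ℤˣ := fun v => if h v = -1 then -1 else 1 with hνdef
  have hν : ∀ v, h v ≠ 0 → h v = ((ν v : ℤ) : ZMod 3) * 1 := fun v hv => h3 _ hv
  set X : Set V := {v | h v ≠ 0} with hX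
  have hU := switchedBoundary_support hν hh hne
  have hXne : X.Nonempty := by
    by_contra hemp
    rw [Set.not_nonempty_iff_eq_empty] at hemp
    have h0 : ∀ v, h v = 0 := fun v => by
      by_contra hv
      exact (hemp ▸ (show v ∈ X from hv) : v ∈ (∅ : Set V))
    refine hne ?_
    rw [show h = 0 from funext h0]
    have := G.coboundary_sub (0 : V → ZMod 3) 0 e
    simpa using this
  refine isColoop_of_isCut_singleton ⟨⟨e, rfl⟩, X, ν, hXne, fun v hv => ?_, hU.symm, ?_, ?_⟩
  · have : h v = 0 := not_not.1 hv
    simp only [hνdef, this]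
    decide
  · refine balanced_of_switchesPositive (ν := ν) fun e' he' => ⟨?_, ?_⟩
    · rintro ⟨i, hi⟩
      obtain ⟨v, -, hv⟩ := he'.1 i
      rw [hi] at hv
      exact absurd hv (by simp)
    · rcases Int.units_eq_one_or ((G.switch ν).sign e') with hs | hs
      · exact hs
      · refine absurd ?_ he'.2
        rw [← hU]
        exact Or.inl (Or.inr ⟨he'.1, hs⟩)
  -- If all of `G.inner X` were balanced, a positive switching of it, extended by zero, would be a
  -- potential `h'` with zero coboundary everywhere. Then `h - h'` competes with `h`, so by
  -- minimality it vanishes nowhere on `X`. Over `ZMod 3` this forces `h = -h'`, contradicting the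
  -- nonzero coboundary of `h`.
  · rintro e' ⟨hin, rfl⟩ hbal
    rw [Set.insert_sdiff_singleton, Set.insert_eq_of_mem hin] at hbal
    obtain ⟨ν', hν'⟩ := balanced_iff_exists_switchesPositive.1 hbal
    set h' : V → ZMod 3 := fun v => if h v = 0 then 0 else ((ν' v : ℤ) : ZMod 3) with hh'
    have hcob : ∀ e'', G.coboundary h' e'' = 0 := by
      intro e''
      by_cases hin' : e'' ∈ G.inner X
      · obtain ⟨u, hu, hu'⟩ := hin' true
        obtain ⟨w, hw, hw'⟩ := hin' false
        exact coboundary_eq_zero_of_switch hu' hw' (hν' e'' hin').2 (x := 1)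
          (by simp [hh', show h u ≠ 0 from hu]) (by simp [hh', show h w ≠ 0 from hw])
      · have hne' : e'' ∉ G.switchedBoundary X ν := by
          rw [hU]
          rintro rfl
          exact hin' hin
        rcases G.isOuter_or_exists_ends e'' with ho | ⟨a, b, ha, hb⟩
        · refine coboundary_eq_zero_of_inc fun v hv => ?_
          by_contra hv0
          refine hne' (Or.inr ⟨ho, v, fun h0 => hv0 ?_, hv⟩)
          simp [hh', h0]
        · by_cases hA : h a = 0 <;> by_cases hB : h b = 0
          · rw [coboundary_of_ends ha hb]
            simp [hh', hA, hB]
          · exact absurd (Or.inl (Or.inl ⟨false, b, hB, a, not_not.2 hA, hb, ha⟩)) hne'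
          · exact absurd (Or.inl (Or.inl ⟨true, a, hA, b, not_not.2 hB, ha, hb⟩)) hne'
          · refine absurd (fun i => ?_) hin'
            cases i
            · exact ⟨b, hB, hb⟩
            · exact ⟨a, hA, ha⟩
    have hle := hmin (h - h') ⟨fun e'' he'' => by rw [coboundary_sub, hh e'' he'', hcob, sub_zero],
      by rwa [coboundary_sub, hcob, sub_zero]⟩
    have hsub : (Finset.univ.filter fun v => (h - h') v ≠ 0) ⊆
        Finset.univ.filter fun v => h v ≠ 0 := by
      intro v
      simp only [Finset.mem_filter, Finset.mem_univ, true_and]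
      intro hv h0
      exact hv (by simp [hh', h0])
    have heq := Finset.eq_of_subset_of_card_le hsub hle
    have hneg : h = 0 - h' := by
      funext v
      by_cases h0 : h v = 0
      · simp [hh', h0]
      · have hv : v ∈ Finset.univ.filter fun v => (h - h') v ≠ 0 := by
          rw [heq]
          simpa using h0
        have hv' : h v ≠ ((ν' v : ℤ) : ZMod 3) := by
          intro hcon
          simp only [Finset.mem_filter, Finset.mem_univ, true_and] at hv
          refine hv ?_
          simp only [Pi.sub_apply, hh', if_neg h0]
          rw [← hcon, sub_self]
        simpa [hh', h0] using h3' _ _ h0 hv'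
    refine hne ?_
    have h00 := G.coboundary_sub h' h' e'
    rw [sub_self, hcob, sub_zero] at h00
    rw [hneg, coboundary_sub, hcob, h00, sub_zero]

end SignedGraph

/-! ### Positivity of an alternating sum, for an abstract rank function. -/

/-- The signed sum of the excesses `t - 1` over the sets between `T` and `T ∪ L`, with signs
alternating with the rank `r`. -/
def signedExcess {ι : Type*} [DecidableEq ι] (r : Finset ι → ℕ) (t : Finset ι → ℤ)
    (T L : Finset ι) : ℤ :=
  ∑ S ∈ L.powerset, (-1) ^ (S.card + r T + r (T ∪ S)) * (t (T ∪ S) - 1)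

section SignedExcess

variable {ι : Type*} [DecidableEq ι] {r : Finset ι → ℕ} {t : Finset ι → ℤ}

/-- The extra minus sign from adding g is cancelled by the drop in rank of the base set. -/
theorem signedExcess_insert {T L : Finset ι} {g : ι} (hg : g ∉ L)
    (hr : r (insert g T) + 1 = r T) :
    signedExcess r t T (insert g L) =
      signedExcess r t T L + signedExcess r t (insert g T) L := by
  unfold signedExcess
  rw [Finset.sum_powerset_insert hg]
  congr 1
  refine Finset.sum_congr rfl fun S hS => ?_
  have hgS : g ∉ S := fun h => hg (Finset.mem_powerset.1 hS h)
  rw [Finset.card_insert_of_notMem hgS, Finset.union_insert, Finset.insert_union, ← hr]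
  congr 1
  rw [show S.card + 1 + (r (insert g T) + 1) + r (insert g (T ∪ S)) =
    S.card + r (insert g T) + r (insert g (T ∪ S)) + 2 by ring, pow_add]
  simp

theorem rank_union_eq
    (hflat : ∀ T T' g, T ⊆ T' → r (insert g T) = r T → r (insert g T') = r T')
    {T L : Finset ι} (hL : ∀ g ∈ L, r (insert g T) = r T) : r (T ∪ L) = r T := by
  induction L using Finset.induction_on with
  | empty => simp
  | insert g L _ ih =>
    rw [Finset.union_insert, hflat T (T ∪ L) g Finset.subset_union_left
      (hL g (Finset.mem_insert_self _ _))]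
    exact ih fun g' hg' => hL g' (Finset.mem_insert_of_mem hg')

/-- Induction on |L|: split off an element that lowers the rank. If there is none, the rank is
constant between T and T ∪ L; for nonempty L the terms -1 cancel and `halt` applies. -/
theorem signedExcess_nonneg
    (hstep : ∀ T g, r (insert g T) = r T ∨ r (insert g T) + 1 = r T)
    (hflat : ∀ T T' g, T ⊆ T' → r (insert g T) = r T → r (insert g T') = r T')
    (ht : ∀ T, 1 ≤ t T)
    (halt : ∀ T L, (∀ S ⊆ L, r (T ∪ S) = r T) →
      0 ≤ ∑ S ∈ L.powerset, (-1) ^ S.card * t (T ∪ S)) (T L : Finset ι) :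
    0 ≤ signedExcess r t T L := by
  induction hn : L.card generalizing T L with
  | zero =>
    rw [Finset.card_eq_zero.1 hn]
    simpa [signedExcess, ← two_mul] using ht T
  | succ n ih =>
    by_cases hg : ∃ g ∈ L, r (insert g T) + 1 = r T
    · obtain ⟨g, hgL, hr⟩ := hg
      rw [← Finset.insert_erase hgL, signedExcess_insert (Finset.notMem_erase g L) hr]
      have hc : (L.erase g).card = n := by rw [Finset.card_erase_of_mem hgL, hn]; rfl
      exact add_nonneg (ih _ _ hc) (ih _ _ hc)
    · push Not at hg
      have hS : ∀ S ⊆ L, r (T ∪ S) = r T := fun S hS => rank_union_eq hflat fun g hgS =>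
        (hstep T g).resolve_right (hg g (hS hgS))
      have h1 : signedExcess r t T L = ∑ S ∈ L.powerset, (-1) ^ S.card * t (T ∪ S) -
          ∑ S ∈ L.powerset, (-1 : ℤ) ^ S.card := by
        rw [signedExcess, ← Finset.sum_sub_distrib]
        refine Finset.sum_congr rfl fun S hSL => ?_
        rw [hS S (Finset.mem_powerset.1 hSL), add_assoc, pow_add, ← two_mul, pow_mul]
        simp [mul_sub]
      have hL : L.Nonempty := Finset.card_pos.1 (by omega)
      rw [h1, Finset.sum_powerset_neg_one_pow_card_of_nonempty hL, sub_zero]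
      exact halt T L hS

/-- Elements are split off as long as some S with t(S) ≠ 1 survives. In the end only S = L can have
t(S) ≠ 1, so the sum is one nonzero term, and it is nonnegative by the previous lemma. -/
theorem signedExcess_pos
    (hstep : ∀ T g, r (insert g T) = r T ∨ r (insert g T) + 1 = r T)
    (hflat : ∀ T T' g, T ⊆ T' → r (insert g T) = r T → r (insert g T') = r T')
    (ht : ∀ T, 1 ≤ t T)
    (halt : ∀ T L, (∀ S ⊆ L, r (T ∪ S) = r T) →
      0 ≤ ∑ S ∈ L.powerset, (-1) ^ S.card * t (T ∪ S))
    (hloop : ∀ g, r {g} + 1 = r ∅) {L : Finset ι} (hL : ∃ S ⊆ L, t S ≠ 1) :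
    0 < signedExcess r t ∅ L := by
  have hnonneg := signedExcess_nonneg hstep hflat ht halt
  induction hn : L.card generalizing L with
  | zero =>
    obtain ⟨S, hS, htS⟩ := hL
    obtain rfl := Finset.card_eq_zero.1 hn
    obtain rfl := Finset.subset_empty.1 hS
    have := lt_of_le_of_ne (ht ∅) (Ne.symm htS)
    simpa [signedExcess, ← two_mul] using this
  | succ n ih =>
    by_cases hg : ∃ g ∈ L, ∃ S ⊆ L.erase g, t S ≠ 1
    · obtain ⟨g, hgL, hS⟩ := hg
      rw [← Finset.insert_erase hgL, signedExcess_insert (Finset.notMem_erase g L) (hloop g)]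
      have hc : (L.erase g).card = n := by rw [Finset.card_erase_of_mem hgL, hn]; rfl
      exact add_pos_of_pos_of_nonneg (ih hS hc) (hnonneg _ _)
    · push Not at hg
      have hproper : ∀ S ⊆ L, S ≠ L → t S = 1 := by
        intro S hS hne
        obtain ⟨g, hgL, hgS⟩ := Finset.exists_of_ssubset (hS.ssubset_of_ne hne)
        exact hg g hgL S fun x hx => Finset.mem_erase.2 ⟨fun h => hgS (h ▸ hx), hS hx⟩
      have htL : t L ≠ 1 := by
        obtain ⟨S, hS, htS⟩ := hL
        by_contra hcon
        exact htS (hproper S hS fun h => htS (h ▸ hcon))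
      refine lt_of_le_of_ne (hnonneg _ _) (Ne.symm ?_)
      rw [signedExcess, Finset.sum_eq_single L]
      · rw [Finset.empty_union]
        exact mul_ne_zero (pow_ne_zero _ (by norm_num)) (sub_ne_zero.2 htL)
      · intro S hS hne
        rw [Finset.empty_union, hproper S (Finset.mem_powerset.1 hS) hne, sub_self, mul_zero]
      · simp

end SignedExcess

/-! ### Counting flows and nowhere-zero flows. -/

namespace SignedGraph

variable {V E : Type*}

theorem edgeBoundary_sub {R : Type*} [CommRing R] [DecidableEq V] [Fintype E]
    (G : SignedGraph V E) (f g : E → R) (v : V) :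
    G.edgeBoundary (f - g) v = G.edgeBoundary f v - G.edgeBoundary g v := by
  simp [edgeBoundary, mul_sub, Finset.sum_sub_distrib]

theorem numBalanced_le [Fintype V] (G : SignedGraph V E) (S : Set E) :
    G.numBalanced S ≤ Fintype.card V := by
  rw [← Nat.card_eq_fintype_card]
  exact (Finite.card_subtype_le _).trans
    (Nat.card_le_card_of_surjective _ Quot.mk_surjective)

section Flows

variable [Fintype V] [DecidableEq V] [Fintype E] (G : SignedGraph V E)

theorem zero_mem_flowsOn (R : Type*) [CommRing R] [Fintype R] (S : Finset E) :
    (0 : E → R) ∈ G.flowsOn R S :=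
  mem_flowsOn.2 ⟨fun _ _ => rfl, fun v => by simp [edgeBoundary]⟩

theorem flowsOn_mono (R : Type*) [CommRing R] [Fintype R] {S S' : Finset E} (h : S ⊆ S') :
    G.flowsOn R S ⊆ G.flowsOn R S' := fun f hf => by
  rw [mem_flowsOn] at hf ⊢
  exact ⟨fun e he => hf.1 e fun h' => he (h h'), hf.2⟩

theorem cycleRank_add_card (S : Finset E) :
    G.cycleRank (S : Set E) + Fintype.card V = S.card + G.numBalanced (S : Set E) := by
  have hb := G.numBalanced_le (S : Set E)
  -- Makes the truncated subtraction in `cycleRank` exact; it follows from duality because the zero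
  -- flow exists.
  have hle : Fintype.card V ≤ S.card + G.numBalanced (S : Set E) := by
    have hdual := G.card_flowsOn_mul 3 S
    rw [card_potentials, show Nat.gcd 3 2 = 1 from rfl, one_pow, mul_one, ← pow_add] at hdual
    refine (Nat.pow_le_pow_iff_right (by norm_num : 1 < 3)).1 ?_
    rw [← hdual]
    exact Nat.le_mul_of_pos_left _ (Finset.card_pos.2 ⟨0, G.zero_mem_flowsOn _ S⟩)
  rw [cycleRank, rank, Set.ncard_coe_finset, Nat.card_eq_fintype_card]
  omega

theorem card_flowsOn (n : ℕ) [NeZero n] (S : Finset E) :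
    (G.flowsOn (ZMod n) S).card =
      n ^ G.cycleRank (S : Set E) * n.gcd 2 ^ G.numUnbalancedClosed (S : Set E) := by
  have hn : 0 < n ^ Fintype.card V := pow_pos (NeZero.pos n) _
  refine Nat.eq_of_mul_eq_mul_right hn ?_
  rw [card_flowsOn_mul, card_potentials, ← mul_assoc, ← pow_add, ← cycleRank_add_card, pow_add]
  ring

theorem card_flowsOn_three (S : Finset E) :
    (G.flowsOn (ZMod 3) S).card = 3 ^ G.cycleRank (S : Set E) := by
  rw [card_flowsOn, show Nat.gcd 3 2 = 1 from rfl, one_pow, mul_one]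

/-- The number of flows supported in the complement of `T` that vanish nowhere on `L`. -/
theorem card_flowsOn_filter [DecidableEq E] (R : Type*) [CommRing R] [Fintype R] [DecidableEq R]
    (T L : Finset E) :
    (((G.flowsOn R Tᶜ).filter fun f => ∀ e ∈ L, f e ≠ 0).card : ℤ) =
      ∑ S ∈ L.powerset, (-1) ^ S.card * ((G.flowsOn R (T ∪ S)ᶜ).card : ℤ) := by
  have h1 : ∀ f : E → R, (if ∀ e ∈ L, f e ≠ 0 then (1 : ℤ) else 0) =
      ∑ S ∈ L.powerset, (-1) ^ S.card * (if ∀ e ∈ S, f e = 0 then 1 else 0) := by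
    intro f
    have h2 : (if ∀ e ∈ L, f e ≠ 0 then (1 : ℤ) else 0) =
        ∏ e ∈ L, (-(if f e = 0 then 1 else 0) + 1) := by
      split_ifs with h
      · rw [Finset.prod_eq_one fun e he => by simp [h e he]]
      · push Not at h
        obtain ⟨e, he, h0⟩ := h
        rw [Finset.prod_eq_zero he (by simp [h0])]
    rw [h2, Finset.prod_add]
    refine Finset.sum_congr rfl fun S _ => ?_
    rw [Finset.prod_const_one, mul_one, Finset.prod_neg]
    congr 1
    split_ifs with h
    · exact Finset.prod_eq_one fun e he => by simp [h e he]
    · push Not at h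
      obtain ⟨e, he, h0⟩ := h
      exact Finset.prod_eq_zero he (by simp [h0])
  rw [Finset.card_filter]
  push_cast
  simp only [h1]
  rw [Finset.sum_comm]
  refine Finset.sum_congr rfl fun S _ => ?_
  rw [← Finset.mul_sum, ← Finset.sum_filter, Finset.sum_const, nsmul_eq_mul, mul_one]
  congr 3
  ext f
  simp only [Finset.mem_filter, mem_flowsOn, Finset.mem_compl, Finset.mem_union, not_not]
  constructor
  · rintro ⟨⟨h, h'⟩, h''⟩
    exact ⟨fun e he => he.elim (h e) (h'' e), h'⟩
  · rintro ⟨h, h'⟩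
    exact ⟨⟨fun e he => h e (Or.inl he), h'⟩, fun e he => h e (Or.inr he)⟩

theorem ncard_nowhereZeroFlows (n : ℕ) [NeZero n] :
    (G.nowhereZeroFlows (ZMod n)).ncard =
      ((G.flowsOn (ZMod n) Finset.univ).filter fun f => ∀ e, f e ≠ 0).card := by
  rw [← Set.ncard_coe_finset]
  refine Set.ncard_congr (fun c _ e => c (G.refArc e)) ?_ ?_ ?_
  · rintro c ⟨-, hb, hne⟩
    simp only [Finset.coe_filter, Set.mem_ofPred_eq, mem_flowsOn]
    refine ⟨⟨fun e he => absurd (Finset.mem_univ e) he, fun v => ?_⟩, fun e => hne _⟩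
    rw [← hb v]
    simp [edgeBoundary, boundary, zsmul_eq_mul]
  · intro c c' hc hc' h
    funext a
    have hc1 : ∀ a, c (Arc.opp a) = - c a := hc.1
    have hc1' : ∀ a, c' (Arc.opp a) = - c' a := hc'.1
    have hr := congrFun h a.edge
    rcases G.arc_eq_or a with ha | ha
    · rw [ha]
      exact hr
    · rw [ha, hc1, hc1']
      exact congrArg _ hr
  · intro f hf
    simp only [Finset.coe_filter, Set.mem_ofPred_eq, mem_flowsOn] at hf
    -- A reference arc has arrow 1 at its `true` end, so this arrow tells the two orientations
    -- apart.
    refine ⟨fun a => (((a.arrow true : ℤˣ) : ℤ) : ZMod n) * f a.edge, ⟨?_, fun v => ?_, ?_⟩, ?_⟩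
    · intro a
      simp [Arc.opp]
    · rw [← hf.1.2 v]
      simp [edgeBoundary, boundary, zsmul_eq_mul, refArc]
    · intro a
      rcases Int.units_eq_one_or (a.arrow true) with h | h <;> simp [h, hf.2 a.edge]
    · funext e
      simp [refArc]

end Flows

/-! ### Cycle-rank of complements and the coefficients. -/

section Rank

variable [Fintype E] [DecidableEq E] (G : SignedGraph V E)

/-- The cycle-rank of the complement of `T`. -/
noncomputable def coRank (T : Finset E) : ℕ := G.cycleRank ((Tᶜ : Finset E) : Set E)

/-- Two to the number of components of the complement of `T` that have no outer-edges and are not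
balanced. -/
noncomputable def torsionCount (T : Finset E) : ℤ :=
  2 ^ G.numUnbalancedClosed ((Tᶜ : Finset E) : Set E)

/-- The coefficients of the flow quasi-polynomial. -/
noncomputable def flowCoeff (k : ℕ) (n : ℤ) : ℤ :=
  ∑ T with G.coRank T = k, (-1) ^ T.card * (if Even n then G.torsionCount T else 1)

theorem one_le_torsionCount (T : Finset E) : 1 ≤ G.torsionCount T :=
  one_le_pow₀ (by norm_num)

theorem coRank_empty : G.coRank ∅ = G.cycleRank Set.univ := by
  simp [coRank]

theorem torsionCount_eq_one (h : ¬ ∃ C, G.IsNegativeCircle C) (T : Finset E) :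
    G.torsionCount T = 1 := by
  rw [torsionCount, numUnbalancedClosed]
  have : IsEmpty {K : (G.linkGraph ((Tᶜ : Finset E) : Set E)).ConnectedComponent //
      (∀ e ∈ G.componentEdges ((Tᶜ : Finset E) : Set E) K, ¬ G.IsOuter e) ∧
      ¬ G.Balanced (G.componentEdges ((Tᶜ : Finset E) : Set E) K)} :=
    ⟨fun K => K.2.2 ⟨K.2.1, fun C _ hC => h ⟨C, hC⟩⟩⟩
  rw [Nat.card_of_isEmpty, pow_zero]

theorem flowCoeff_periodic_two (k : ℕ) : Function.Periodic (G.flowCoeff k) 2 := by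
  intro n
  simp [flowCoeff]

variable [Fintype V]

/-- The circle is connected and has no outer-edges, so it lies in one component of its own edge set,
which is counted by `numUnbalancedClosed`. -/
theorem torsionCount_compl_ne_one {C : Finset E} (hC : G.IsNegativeCircle C) :
    G.torsionCount Cᶜ ≠ 1 := by
  rw [torsionCount, compl_compl]
  obtain ⟨e, he⟩ := hC.1.1
  obtain ⟨u, w, hu, hw⟩ := exists_ends_of_not_isOuter (hC.1.2.1 e he)
  have hsub : (C : Set E) ⊆ G.componentEdges (C : Set E)
      ((G.linkGraph (C : Set E)).connectedComponentMk u) := by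
    intro e' he'
    obtain ⟨u', w', hu', hw'⟩ := exists_ends_of_not_isOuter (hC.1.2.1 e' he')
    refine ⟨he', u', ?_, true, hu'⟩
    exact SimpleGraph.ConnectedComponent.sound
      (hC.1.2.2.2 u' u ⟨e', he', true, hu'⟩ ⟨e, he, true, hu⟩)
  have hpos : 0 < G.numUnbalancedClosed (C : Set E) := by
    have : Nonempty {K : (G.linkGraph (C : Set E)).ConnectedComponent //
      (∀ e ∈ G.componentEdges (C : Set E) K, ¬ G.IsOuter e) ∧
      ¬ G.Balanced (G.componentEdges (C : Set E) K)} :=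
      ⟨⟨(G.linkGraph (C : Set E)).connectedComponentMk u, fun e' he' => hC.1.2.1 e' he'.1,
        fun hb => hb.2 C hsub hC⟩⟩
    exact Nat.card_pos
  exact ne_of_gt (one_lt_pow₀ (by norm_num) hpos.ne')

variable [DecidableEq V]

theorem card_flowsOn_compl_three (T : Finset E) :
    (G.flowsOn (ZMod 3) Tᶜ).card = 3 ^ G.coRank T :=
  G.card_flowsOn_three _

theorem coRank_anti {T T' : Finset E} (h : T ⊆ T') : G.coRank T' ≤ G.coRank T := by
  refine (Nat.pow_le_pow_iff_right (by norm_num : 1 < 3)).1 ?_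
  rw [← card_flowsOn_compl_three, ← card_flowsOn_compl_three]
  exact Finset.card_le_card (G.flowsOn_mono _ (Finset.compl_subset_compl.2 h))

/-- Each of the three fibres of f ↦ f(g) is empty or a translate of the flows vanishing at g. -/
theorem coRank_le_succ (T : Finset E) (g : E) : G.coRank T ≤ G.coRank (insert g T) + 1 := by
  refine (Nat.pow_le_pow_iff_right (by norm_num : 1 < 3)).1 ?_
  rw [pow_succ, ← card_flowsOn_compl_three, ← card_flowsOn_compl_three]
  refine (Finset.card_le_mul_card_image_of_maps_to (f := fun f : E → ZMod 3 => f g)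
    (t := Finset.univ) (fun _ _ => Finset.mem_univ _)
    (G.flowsOn (ZMod 3) (insert g T)ᶜ).card fun x _ => ?_).trans (le_of_eq ?_)
  · by_cases hne : ((G.flowsOn (ZMod 3) Tᶜ).filter fun f => f g = x).Nonempty
    · obtain ⟨f₀, hf₀⟩ := hne
      rw [Finset.mem_filter, mem_flowsOn] at hf₀
      refine Finset.card_le_card_of_injOn (fun f => f - f₀) (fun f hf => ?_)
        fun f _ f' _ h => sub_left_injective h
      rw [Finset.mem_coe, Finset.mem_filter, mem_flowsOn] at hf
      rw [Finset.mem_coe, mem_flowsOn]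
      refine ⟨fun e he => ?_, fun v => by rw [edgeBoundary_sub, hf.1.2, hf₀.1.2, sub_zero]⟩
      rw [Finset.mem_compl, not_not, Finset.mem_insert] at he
      rcases he with rfl | he
      · exact sub_eq_zero.2 (hf.2.trans hf₀.2.symm)
      · exact sub_eq_zero.2 ((hf.1.1 e (by simpa using he)).trans
          (hf₀.1.1 e (by simpa using he)).symm)
    · rw [Finset.not_nonempty_iff_eq_empty.1 hne]
      simp
  · rw [Finset.card_univ, ZMod.card]

theorem coRank_insert (T : Finset E) (g : E) :
    G.coRank (insert g T) = G.coRank T ∨ G.coRank (insert g T) + 1 = G.coRank T := by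
  have h1 := G.coRank_anti (Finset.subset_insert g T)
  have h2 := G.coRank_le_succ T g
  omega

/-- Equal ranks mean that every `ZMod 3`-flow vanishing on T vanishes at g; this passes to larger
sets. -/
theorem coRank_insert_of_subset (T T' : Finset E) (g : E) (hT : T ⊆ T')
    (h : G.coRank (insert g T) = G.coRank T) : G.coRank (insert g T') = G.coRank T' := by
  refine le_antisymm (G.coRank_anti (Finset.subset_insert g T')) ?_
  refine (Nat.pow_le_pow_iff_right (by norm_num : 1 < 3)).1 ?_
  have heq := Finset.eq_of_subset_of_card_le (G.flowsOn_mono (ZMod 3)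
    (Finset.compl_subset_compl.2 (Finset.subset_insert g T)))
    (by rw [card_flowsOn_compl_three, card_flowsOn_compl_three, h])
  rw [← card_flowsOn_compl_three, ← card_flowsOn_compl_three]
  refine Finset.card_le_card fun f hf => ?_
  have hf' : f ∈ G.flowsOn (ZMod 3) (insert g T)ᶜ := by
    rw [heq]
    exact G.flowsOn_mono _ (Finset.compl_subset_compl.2 hT) hf
  rw [mem_flowsOn] at hf hf' ⊢
  refine ⟨fun e he => ?_, hf.2⟩
  rw [Finset.mem_compl, not_not, Finset.mem_insert] at he
  rcases he with rfl | he
  · exact hf'.1 e (by simp)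
  · exact hf.1 e (by simpa using he)

/-- Multiplied by a power of 2, the sum counts the `ZMod 2`-flows that vanish on T and nowhere on L.
-/
theorem alternating_torsionCount_nonneg (T L : Finset E)
    (hL : ∀ S ⊆ L, G.coRank (T ∪ S) = G.coRank T) :
    0 ≤ ∑ S ∈ L.powerset, (-1) ^ S.card * G.torsionCount (T ∪ S) := by
  have h := G.card_flowsOn_filter (ZMod 2) T L
  have h2 : ∑ S ∈ L.powerset, (-1) ^ S.card * ((G.flowsOn (ZMod 2) (T ∪ S)ᶜ).card : ℤ) =
      2 ^ G.coRank T * ∑ S ∈ L.powerset, (-1) ^ S.card * G.torsionCount (T ∪ S) := by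
    rw [Finset.mul_sum]
    refine Finset.sum_congr rfl fun S hS => ?_
    rw [card_flowsOn, ← hL S (Finset.mem_powerset.1 hS), coRank, torsionCount, Nat.gcd_self]
    push_cast
    ring
  rw [h2] at h
  have h3 : (0 : ℤ) ≤ 2 ^ G.coRank T *
      ∑ S ∈ L.powerset, (-1) ^ S.card * G.torsionCount (T ∪ S) := h ▸ Int.natCast_nonneg _
  exact nonneg_of_mul_nonneg_right h3 (by positivity)

/-- If the rank did not drop, duality would give three times as many potentials for the graph
without g as for the whole graph, so some potential would have nonzero coboundary at g only, making
g a co-loop. -/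
theorem coRank_singleton {g : E} (hg : ¬ G.IsColoop g) : G.coRank {g} + 1 = G.coRank ∅ := by
  refine (G.coRank_insert ∅ g).resolve_left fun heq => hg (isColoop_of_coboundary ?_)
  by_contra hcon
  push Not at hcon
  have hd := G.card_flowsOn_mul 3 (insert g ∅)ᶜ
  have hd' := G.card_flowsOn_mul 3 ∅ᶜ
  rw [card_flowsOn_compl_three, heq] at hd
  rw [card_flowsOn_compl_three, hd] at hd'
  have hle : (G.potentials (ZMod 3) (insert g ∅)ᶜ).card ≤ (G.potentials (ZMod 3) ∅ᶜ).card := by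
    refine Finset.card_le_card fun h hh => ?_
    rw [mem_potentials] at hh ⊢
    have h1 : ∀ e ≠ g, G.coboundary h e = 0 := fun e he => hh e (by simpa using he)
    intro e _
    by_cases he : e = g
    · exact he ▸ hcon h h1
    · exact h1 e he
  have hpos : 0 < (G.potentials (ZMod 3) ∅ᶜ).card := by
    rw [card_potentials]
    positivity
  have hcard : (∅ᶜ : Finset E).card = (insert g ∅ : Finset E)ᶜ.card + 1 := by
    have hE : 0 < Fintype.card E := Fintype.card_pos_iff.2 ⟨g⟩
    rw [Finset.card_compl, Finset.card_compl]
    simp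
    omega
  rw [hcard, pow_succ, mul_assoc] at hd'
  have := Nat.eq_of_mul_eq_mul_left (by positivity) hd'
  omega

theorem isQuasiPolynomialCoeff_flowCoeff :
    IsQuasiPolynomialCoeff G.flowCoeff (G.cycleRank Set.univ) where
  periodic := ⟨2, by norm_num, G.flowCoeff_periodic_two⟩
  vanish k hk := by
    funext n
    rw [flowCoeff, Finset.filter_false_of_mem, Finset.sum_empty, Pi.zero_apply]
    intro T _ hT
    have := G.coRank_anti (Finset.empty_subset T)
    rw [coRank_empty] at this
    omega

theorem sum_range_coRank (F : ℕ → Finset E → ℤ) :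
    ∑ k ∈ Finset.range (G.cycleRank Set.univ + 1), ∑ T with G.coRank T = k, F k T =
      ∑ T, F (G.coRank T) T := by
  rw [← Finset.sum_fiberwise_of_maps_to (s := Finset.univ)
    (t := Finset.range (G.cycleRank Set.univ + 1)) (g := G.coRank)]
  · refine Finset.sum_congr rfl fun k _ => Finset.sum_congr rfl fun T hT => ?_
    rw [(Finset.mem_filter.1 hT).2]
  · intro T _
    rw [Finset.mem_range, Nat.lt_succ_iff, ← coRank_empty]
    exact G.coRank_anti (Finset.empty_subset T)

theorem quasiEval_flowCoeff (n : ℕ) [NeZero n] :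
    quasiEval G.flowCoeff (G.cycleRank Set.univ) n = (G.nowhereZeroFlows (ZMod n)).ncard := by
  have h := G.card_flowsOn_filter (ZMod n) ∅ Finset.univ
  simp only [Finset.compl_empty, Finset.mem_univ, true_imp_iff, Finset.powerset_univ,
    Finset.empty_union] at h
  rw [ncard_nowhereZeroFlows, h, quasiEval]
  simp only [flowCoeff, Finset.sum_mul, Int.cast_id]
  rw [G.sum_range_coRank fun k T =>
    (-1) ^ T.card * (if Even (n : ℤ) then G.torsionCount T else 1) * (((n : ℤ) : ℤ) : ℤ) ^ k]
  refine Finset.sum_congr rfl fun T _ => ?_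
  rw [card_flowsOn, coRank, torsionCount]
  rcases Nat.even_or_odd n with hn | hn
  · rw [if_pos ((Int.even_coe_nat n).2 hn), Nat.gcd_eq_right hn.two_dvd]
    push_cast
    ring
  · rw [if_neg fun h => Nat.not_even_iff_odd.2 hn ((Int.even_coe_nat n).1 h),
      Nat.Coprime.gcd_eq_one hn.coprime_two_right]
    push_cast
    ring

theorem flowCoeff_cycleRank_ne_zero (hG : ∀ e, ¬ G.IsColoop e) :
    G.flowCoeff (G.cycleRank Set.univ) ≠ 0 := by
  intro h
  -- An odd argument removes the torsion factor.
  have h1 := congrFun h 1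
  have hfilter : (Finset.univ.filter fun T => G.coRank T = G.cycleRank Set.univ) = {∅} := by
    ext T
    simp only [Finset.mem_filter, Finset.mem_univ, true_and, Finset.mem_singleton]
    refine ⟨fun hT => ?_, fun hT => hT ▸ G.coRank_empty⟩
    by_contra hne
    obtain ⟨g, hg⟩ := Finset.nonempty_iff_ne_empty.2 hne
    have h2 := G.coRank_anti (Finset.singleton_subset_iff.2 hg)
    have h3 := G.coRank_singleton (hG g)
    rw [← coRank_empty] at hT
    omega
  rw [flowCoeff, hfilter, Finset.sum_singleton] at h1
  simp at h1

theorem exists_not_periodic_one (hG : ∀ e, ¬ G.IsColoop e) {C : Finset E}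
    (hC : G.IsNegativeCircle C) : ∃ k, ¬ Function.Periodic (G.flowCoeff k) 1 := by
  by_contra hcon
  push Not at hcon
  have hk : ∀ k, ∑ T with G.coRank T = k, (-1) ^ T.card * (G.torsionCount T - 1) = 0 := by
    intro k
    have h := hcon k 0
    simp only [flowCoeff] at h
    simp only [mul_sub, Finset.sum_sub_distrib]
    rw [sub_eq_zero]
    simpa using h.symm
  have hpos := signedExcess_pos G.coRank_insert G.coRank_insert_of_subset G.one_le_torsionCount
    G.alternating_torsionCount_nonneg (fun g => G.coRank_singleton (hG g)) (L := Finset.univ)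
    ⟨Cᶜ, Finset.subset_univ _, G.torsionCount_compl_ne_one hC⟩
  refine hpos.ne' ?_
  rw [signedExcess, Finset.powerset_univ]
  simp only [Finset.empty_union]
  -- Grouping by rank exhibits the excess, up to sign, as the value at -1 of the polynomial whose
  -- coefficients are the sums in `hk`.
  rw [← G.sum_range_coRank fun k T =>
    (-1) ^ (T.card + G.coRank ∅ + k) * (G.torsionCount T - 1)]
  refine Finset.sum_eq_zero fun k _ => ?_
  rw [← mul_zero ((-1 : ℤ) ^ (G.coRank ∅ + k)), ← hk k, Finset.mul_sum]
  refine Finset.sum_congr rfl fun T _ => ?_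
  ring

end Rank

end SignedGraph

/-! ### Uniqueness of quasi-polynomials and the main theorem. -/

theorem quasiEval_eq_of_le {R : Type*} [Ring R] {a : ℕ → ℤ → R} {d D : ℕ}
    (ha : IsQuasiPolynomialCoeff a d) (hD : d ≤ D) (n : ℤ) :
    quasiEval a d n = quasiEval a D n := by
  refine Finset.sum_subset (Finset.range_mono (by omega)) fun k _ hk => ?_
  rw [ha.vanish k (by simpa using hk), Pi.zero_apply, zero_mul]

/-- A quasi-polynomial is determined by its values at all large natural numbers. -/
theorem IsQuasiPolynomialCoeff.ext {a b : ℕ → ℤ → ℂ} {d₁ d₂ : ℕ}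
    (ha : IsQuasiPolynomialCoeff a d₁) (hb : IsQuasiPolynomialCoeff b d₂) (m : ℕ)
    (h : ∀ n : ℕ, m ≤ n → quasiEval a d₁ n = quasiEval b d₂ n) : a = b := by
  obtain ⟨N₁, hN₁, hp₁⟩ := ha.periodic
  obtain ⟨N₂, hN₂, hp₂⟩ := hb.periodic
  set D := max d₁ d₂
  funext k n
  set p : Polynomial ℂ := ∑ k ∈ Finset.range (D + 1), Polynomial.monomial k (a k n - b k n) with hp
  -- Infinitely many arguments congruent to `n` modulo both periods. There the coefficients are
  -- frozen, so the difference is the single polynomial `p`; the shift by `n.natAbs + m` makes every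
  -- argument at least `m`.
  set x : ℕ → ℤ := fun j => n + ((j + n.natAbs + m) * N₂ : ℕ) * (N₁ : ℤ) with hx
  have hroot : ∀ j, p.IsRoot ((x j : ℤ) : ℂ) := by
    intro j
    have hxa : ∀ k, a k (x j) = a k n := fun k => (hp₁ k).int_mul _ n
    have hxb : ∀ k, b k (x j) = b k n := by
      intro k
      have : x j = n + ((j + n.natAbs + m) * N₁ : ℕ) * (N₂ : ℤ) := by
        simp only [hx]
        push_cast
        ring
      rw [this]
      exact (hp₂ k).int_mul _ n
    have hxm : (m : ℤ) ≤ x j := by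
      have h1 : (1 : ℤ) ≤ N₂ * N₁ := by exact_mod_cast Nat.mul_pos hN₂ hN₁
      have h2 : ((j + n.natAbs + m : ℕ) : ℤ) ≤ ((j + n.natAbs + m) * N₂ : ℕ) * (N₁ : ℤ) := by
        rw [Nat.cast_mul, mul_assoc]
        exact le_mul_of_one_le_right (Int.natCast_nonneg _) h1
      have h3 : x j = n + ((j + n.natAbs + m) * N₂ : ℕ) * (N₁ : ℤ) := rfl
      omega
    obtain ⟨y, hy⟩ := Int.eq_ofNat_of_zero_le (le_trans (Int.natCast_nonneg m) hxm)
    have hval := h y (by omega)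
    rw [quasiEval_eq_of_le ha (le_max_left _ _ : d₁ ≤ D),
      quasiEval_eq_of_le hb (le_max_right _ _ : d₂ ≤ D), ← hy] at hval
    simp only [quasiEval, hxa, hxb] at hval
    rw [Polynomial.IsRoot.def, hp, Polynomial.eval_finsetSum]
    simp only [Polynomial.eval_monomial, sub_mul, Finset.sum_sub_distrib]
    rw [hval, sub_self]
  have hp0 : p = 0 := by
    refine Polynomial.eq_zero_of_infinite_isRoot p
      (Set.infinite_of_injective_forall_mem (f := fun j => ((x j : ℤ) : ℂ)) ?_ hroot)
    intro i j hij
    have h1 : x i = x j := Int.cast_injective hij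
    simp only [hx, add_right_inj] at h1
    have h2 := mul_right_cancel₀ (by exact_mod_cast hN₁.ne') h1
    have h3 := Nat.eq_of_mul_eq_mul_right hN₂ (Int.ofNat_inj.1 h2)
    omega
  by_cases hk : k ≤ D
  · have hc : p.coeff k = a k n - b k n := by
      rw [hp, Polynomial.finsetSum_coeff, Finset.sum_eq_single k]
      · simp
      · intro i _ hi
        rw [Polynomial.coeff_monomial, if_neg hi]
      · intro hk'
        exact absurd (Finset.mem_range.2 (by omega)) hk'
    rw [hp0, Polynomial.coeff_zero] at hc
    exact (sub_eq_zero.1 hc.symm)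
  · rw [ha.vanish k (by omega), hb.vanish k (by omega)]

theorem IsQuasiPolynomialCoeff.intCast {a : ℕ → ℤ → ℤ} {d : ℕ} (ha : IsQuasiPolynomialCoeff a d) :
    IsQuasiPolynomialCoeff (fun k n => ((a k n : ℤ) : ℂ)) d where
  periodic := by
    obtain ⟨N, hN, hp⟩ := ha.periodic
    exact ⟨N, hN, fun k n => congrArg _ (hp k n)⟩
  vanish k hk := by
    funext n
    simp [ha.vanish k hk]

theorem mainTheorem11 {V E : Type*} [Fintype V] [DecidableEq V] [Fintype E]
    (G : SignedGraph V E) (hG : ∀ e, ¬ G.IsColoop e) :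
    ∃ a : ℕ → ℤ → ℤ,
      -- a quasi-polynomial of degree equal to the cycle-rank
      IsQuasiPolynomialCoeff a (G.cycleRank Set.univ) ∧
      a (G.cycleRank Set.univ) ≠ 0 ∧
      -- whose values count the nowhere-zero flows over the integers modulo n
      (∀ n : ℕ, 2 ≤ n →
        quasiEval a (G.cycleRank Set.univ) n = (G.nowhereZeroFlows (ZMod n)).ncard) ∧
      -- with a negative circle, the period is exactly two
      ((∃ C, G.IsNegativeCircle C) →
        (∀ k, Function.Periodic (a k) 2) ∧ ∃ k, ¬ Function.Periodic (a k) 1) ∧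
      -- without negative circles, the period is one
      ((¬ ∃ C, G.IsNegativeCircle C) → ∀ k, Function.Periodic (a k) 1) ∧
      -- it is the only quasi-polynomial with these values, of whatever degree and period
      (∀ (b : ℕ → ℤ → ℂ) (d : ℕ), IsQuasiPolynomialCoeff b d →
        (∀ n : ℕ, 2 ≤ n → quasiEval b d n = (G.nowhereZeroFlows (ZMod n)).ncard) →
        ∀ k n, b k n = a k n) := by
  classical
  refine ⟨G.flowCoeff, G.isQuasiPolynomialCoeff_flowCoeff, G.flowCoeff_cycleRank_ne_zero hG,
    fun n hn => ?_, fun ⟨C, hC⟩ => ⟨G.flowCoeff_periodic_two, G.exists_not_periodic_one hG hC⟩,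
    fun h k n => ?_, fun b d hb hval k n => ?_⟩
  · have : NeZero n := ⟨by omega⟩
    exact G.quasiEval_flowCoeff n
  · simp only [SignedGraph.flowCoeff, G.torsionCount_eq_one h, ite_self]
  · refine congrFun (congrFun
      (hb.ext G.isQuasiPolynomialCoeff_flowCoeff.intCast 2 fun n hn => ?_) k) n
    have : NeZero n := ⟨by omega⟩
    rw [hval n hn, ← Int.cast_natCast (R := ℂ) (Set.ncard _), ← G.quasiEval_flowCoeff n]
    simp [quasiEval]
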